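/- For $\kappa\in\mathbb C$ let $E_\kappa(z)=\exp(z+\kappa)$, and let $F(t)=e^t-1$ for $t\ge 0$. Let $\mathcal S_0$ be the set of integer sequences $s=(s_1,s_2,\dots)$ for which there is an $x>0$ with $|s_{k+1}|\le F^{\circ k}(x)$ for all $k\ge 0$, let $\sigma$ be the shift map on $\mathcal S_0$, and for $s\in\mathcal S_0$ put $$t_s=\inf\Big\{x>0:\ \limsup_{n\to\infty}\frac{|s_n|}{F^{\circ(n-1)}(x)}=0\Big\},\qquad t_s^*=\sup_{n\ge1}F^{\circ(-n+1)}(|s_n|).$$ For $j\in\mathbb Z$ let $L_{\kappa,j}(z)=\operatorname{Log}z-\kappa+2\pi i j$ with the principal branch $\operatorname{Log}$ of the logarithm. The dynamic ray $g_s^\kappa$ is defined as follows. For $t>t_s^*+2\log(|\kappa|+3)$ let $$g_s^\kappa(t)=\lim_{m\to\infty}L_{\kappa,s_1}\circ\dots\circ L_{\kappa,s_m}\big(F^{\circ m}(t)\big).$$ These ray tails are extended to smaller potentials by continuous lifting under $E_\kappa$: for $t_0>t_s$ the value $g_s^\kappa(t_0)$ is defined if there are continuous functions $\gamma_n:[F^{\circ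 n}(t_0),\infty)\to\mathbb C$ $(n\ge0)$ with $E_\kappa(\gamma_n(t))=\gamma_{n+1}(F(t))$ for all $n\ge 0$ and $t\ge F^{\circ n}(t_0)$, such that $\gamma_n(t)=g_{\sigma^n s}^\kappa(t)$ for all $n\ge 0$ and all $t\ge F^{\circ n}(t_0)$ with $t>t_{\sigma^n s}^*+2\log(|\kappa|+3)$; the $\gamma_n$ are then unique, and $g_s^\kappa(t_0)=\gamma_0(t_0)$. For $t>t_s$ let $$\mathcal G_s(t)=\{\kappa\in\mathbb C:\ g_s^\kappa(t)\text{ is defined and }g_s^\kappa(t)=0\}.$$ **Proposition 3.3 (A Bound on the Growth of Parameter Rays).** For every $s\in\mathcal S_0$ there is a continuous function $\xi_s:(t_s,\infty)\to\mathbb R$ such that for every $t>t_s$ every $\kappa\in\mathcal G_s(t)$ satisfies $|\kappa|<\xi_s(t)$. Moreover, $\xi_s$ can be chosen such that $\xi_s(t)=2t$ for all sufficiently large $t$. -/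

import Mathlib

open Filter Topology Set

namespace ExpFamily

noncomputable section

/-- The exponential map `E_κ(z) = exp (z + κ)`. -/
def expMap (κ z : ℂ) : ℂ := Complex.exp (z + κ)

/-- The model map `F(t) = e ^ t - 1`, used on `[0, ∞)`. -/
def F (t : ℝ) : ℝ := Real.exp t - 1

/-- The inverse `y ↦ log (y + 1)` of the model map, used on `[0, ∞)`. -/
def Finv (y : ℝ) : ℝ := Real.log (y + 1)

/-- Sequences `(s_1, s_2, …)` of integers. Indices start at `0`, so `s n` is the entry `s_{n+1}`. -/
abbrev Address := ℕ → ℤ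

/-- The `n`-th iterate of the shift map. -/
def shift (n : ℕ) (s : Address) : Address := fun k => s (n + k)

/-- Exponentially bounded sequences: there is a growth parameter `x > 0` with
`|s_{k+1}| ≤ F^{∘ k}(x)` for all `k ≥ 0`. -/
def ExpBounded (s : Address) : Prop :=
  ∃ x : ℝ, 0 < x ∧ ∀ k : ℕ, |(s k : ℝ)| ≤ F^[k] x

/-- The minimal potential
`t_s = inf {x > 0 : limsup_{n → ∞} |s_n| / F^{∘ (n-1)}(x) = 0}`. The quotients are non-negative,
so that the limsup vanishes exactly when they tend to `0`. -/
def minPotential (s : Address) : ℝ :=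
  sInf {x : ℝ | 0 < x ∧ Tendsto (fun n : ℕ => |(s n : ℝ)| / F^[n] x) atTop (𝓝 0)}

/-- The potential `t_s^* = sup_{n ≥ 1} F^{∘ (-n+1)}(|s_n|)`, which is finite for exponentially
bounded `s`. -/
def supPotential (s : Address) : ℝ :=
  ⨆ n : ℕ, Finv^[n] |(s n : ℝ)|

/-- The potential `t_s^* + 2 log (|κ| + 3)`, beyond which the ray is the limit of `tailApprox`. -/
def tailPotential (κ : ℂ) (s : Address) : ℝ :=
  supPotential s + 2 * Real.log (‖κ‖ + 3)

/-- The inverse branch `L_{κ,j}(z) = Log z - κ + 2πij` of `E_κ`, with the principal logarithm. -/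
def invBranch (κ : ℂ) (j : ℤ) (z : ℂ) : ℂ :=
  Complex.log z - κ + 2 * (Real.pi : ℂ) * Complex.I * (j : ℂ)

/-- `tailApprox κ m s t = L_{κ,s_1} ∘ ⋯ ∘ L_{κ,s_m} (F^{∘ m}(t))`. -/
def tailApprox (κ : ℂ) : ℕ → Address → ℝ → ℂ
  | 0, _, t => (t : ℂ)
  | m + 1, s, t => invBranch κ (s 0) (tailApprox κ m (shift 1 s) (F t))

/-- `γ n`, restricted to `[F^{∘ n}(t₀), ∞)`, is the dynamic ray `g_{σ^n s}^κ` for every `n ≥ 0`.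

For potentials `t` beyond `tailPotential` the ray is the limit of the pull-backs
`L_{κ,s_1} ∘ ⋯ ∘ L_{κ,s_m} (F^{∘ m}(t))`. For smaller potentials it is the continuous
extension of this tail that satisfies `E_κ (g_s^κ(t)) = g_{σ s}^κ(F(t))`, that is, the continuous
lift of the ray of address `σ s` under `E_κ`. When `s` is exponentially bounded and
`t₀ > t_s`, these conditions determine every `γ n` on `[F^{∘ n}(t₀), ∞)`, because
`F^{∘ n}(t₀)` lies beyond the tail potential of `σ^n s` for all large `n`. The lifts fail to
exist exactly if, for some `n ≥ 1`, the ray of address `σ^n s` meets the omitted value `0` of `E_κ`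
at a potential `≥ F^{∘ n}(t₀)`. -/
structure IsDynamicRay (κ : ℂ) (s : Address) (t₀ : ℝ) (γ : ℕ → ℝ → ℂ) : Prop where
  continuousOn : ∀ n : ℕ, ContinuousOn (γ n) (Ici (F^[n] t₀))
  semiconj : ∀ n : ℕ, ∀ t : ℝ, F^[n] t₀ ≤ t → expMap κ (γ n t) = γ (n + 1) (F t)
  tail : ∀ n : ℕ, ∀ t : ℝ, F^[n] t₀ ≤ t → tailPotential κ (shift n s) < t →
    Tendsto (fun m : ℕ => tailApprox κ m (shift n s) t) atTop (𝓝 (γ n t))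

/-- `g_s^κ(t)` is defined and equal to `z`. -/
def RayAt (κ : ℂ) (s : Address) (t : ℝ) (z : ℂ) : Prop :=
  ∃ γ : ℕ → ℝ → ℂ, IsDynamicRay κ s t γ ∧ γ 0 t = z

/-- The set `𝒢_s(t)` of all parameters `κ` for which `g_s^κ(t)` is defined and equal to `0`. -/
def paramSet (s : Address) (t : ℝ) : Set ℂ := {κ : ℂ | RayAt κ s t 0}

end

end ExpFamily

/-! Write `Γ n = γ n + κ`. These curves are the rays of `w ↦ exp w + κ`, and `κ ∈ paramSet s t` says
that the ray of level 0 meets the singular value `κ` at potential `t`. If `t` lies in the tail, then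
`κ` is within 1/4 of `t + 2πi s 0`, so `‖κ‖ < 2t` for large `‖κ‖`.

Otherwise, for `t` bounded away from `t_s`, the levels at which the singular orbit `w k = Γ k (F^[k]
t)` is still outside the tail, and the tail potentials there, are bounded by `ℓ = C log (‖κ‖ + 3)`
(`ExpBounded.exists_bad_bound`). `SingularRay.norm_le` bounds `‖κ‖` by a polynomial in `ℓ`, which is
impossible for large `‖κ‖`. It rests on three facts. (1) `Re κ ≥ -2`, since otherwise the singular
orbit cannot escape. (2) `|Im κ|` is at most linear in `ℓ`, by counting how far arguments turn along
lifts (`abs_im_kappa_le`). (3) `Re κ ≤ ℓ ^ 4 + 1`. Otherwise the largest modulus `Y` among the `w k`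
up to the tail is at least `exp (ℓ ^ 4)`. At the point `w k` where it is attained, the real part is
at most `log (2Y)`, as the next point is no larger than `Y`, and is above `-Y/2`, as otherwise the
orbit would return near `κ` forever (`neg_half_lt_re`). Hence `|Im (w k)|` would be of order `Y`.
But the rays are Lipschitz with a constant far smaller than `Y` (`rightLipAt`), and joining `w k` to
the tail along its ray shows that `|Im (w k)| < Y/2`.

Local bounds are finally glued to a continuous function. -/

namespace ExpFamily

/-! ### The model map -/

lemma F_strictMono : StrictMono F := fun _ _ h => sub_lt_sub_right (Real.exp_lt_exp.2 h) 1

lemma F_iterate_strictMono (n : ℕ) : StrictMono F^[n] := F_strictMono.iterate n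

lemma le_F (x : ℝ) : x ≤ F x := by
  have := Real.add_one_le_exp x
  unfold F; linarith

lemma F_nonneg {x : ℝ} (hx : 0 ≤ x) : 0 ≤ F x := hx.trans (le_F x)

lemma F_iterate_nonneg (n : ℕ) {x : ℝ} (hx : 0 ≤ x) : 0 ≤ F^[n] x := by
  induction n with
  | zero => simpa
  | succ n ih => rw [Function.iterate_succ_apply']; exact F_nonneg ih

lemma le_F_iterate (n : ℕ) (x : ℝ) : x ≤ F^[n] x := by
  induction n with
  | zero => simp
  | succ n ih => rw [Function.iterate_succ_apply']; exact ih.trans (le_F _)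

lemma F_iterate_le_iterate {m n : ℕ} (h : m ≤ n) (x : ℝ) : F^[m] x ≤ F^[n] x := by
  obtain ⟨k, rfl⟩ := Nat.exists_eq_add_of_le' h
  rw [Function.iterate_add_apply]
  exact le_F_iterate k _

lemma F_add_le {a b : ℝ} (ha : 0 ≤ a) (hb : 0 ≤ b) : F a + F b ≤ F (a + b) := by
  have h1 := Real.one_le_exp ha
  have h2 := Real.one_le_exp hb
  unfold F
  rw [Real.exp_add]
  nlinarith

lemma F_iterate_add_le (n : ℕ) {a b : ℝ} (ha : 0 ≤ a) (hb : 0 ≤ b) :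
    F^[n] a + F^[n] b ≤ F^[n] (a + b) := by
  induction n with
  | zero => simp
  | succ n ih =>
    simp only [Function.iterate_succ_apply']
    exact (F_add_le (F_iterate_nonneg n ha) (F_iterate_nonneg n hb)).trans
      (F_strictMono.monotone ih)

lemma F_Finv {y : ℝ} (hy : 0 ≤ y) : F (Finv y) = y := by
  rw [F, Finv, Real.exp_log (by linarith)]; ring

lemma Finv_nonneg {y : ℝ} (hy : 0 ≤ y) : 0 ≤ Finv y := Real.log_nonneg (by linarith)

lemma Finv_iterate_nonneg (n : ℕ) {y : ℝ} (hy : 0 ≤ y) : 0 ≤ Finv^[n] y := by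
  induction n with
  | zero => simpa
  | succ n ih => rw [Function.iterate_succ_apply']; exact Finv_nonneg ih

lemma Finv_iterate_le {n : ℕ} {x y : ℝ} (hy : 0 ≤ y) (h : y ≤ F^[n] x) : Finv^[n] y ≤ x := by
  induction n generalizing y with
  | zero => simpa using h
  | succ n ih =>
    rw [Function.iterate_succ_apply]
    refine ih (Finv_nonneg hy) ?_
    rwa [← F_strictMono.le_iff_le, F_Finv hy, ← Function.iterate_succ_apply' F]

/-! ### The potential `t_s^*` -/

/-- The supremum defining `supPotential s` is finite. -/
def PotentialBdd (s : Address) : Prop := BddAbove (range fun n : ℕ => Finv^[n] |(s n : ℝ)|)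

lemma ExpBounded.potentialBdd {s : Address} (hs : ExpBounded s) : PotentialBdd s := by
  obtain ⟨x, -, hx⟩ := hs
  refine ⟨x, ?_⟩
  rintro _ ⟨n, rfl⟩
  exact Finv_iterate_le (abs_nonneg _) (hx n)

lemma PotentialBdd.le {s : Address} (hs : PotentialBdd s) (n : ℕ) :
    Finv^[n] |(s n : ℝ)| ≤ supPotential s := le_ciSup hs n

lemma PotentialBdd.abs_le {s : Address} (hs : PotentialBdd s) :
    |(s 0 : ℝ)| ≤ supPotential s := hs.le 0

lemma PotentialBdd.nonneg {s : Address} (hs : PotentialBdd s) : 0 ≤ supPotential s :=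
  (abs_nonneg _).trans hs.abs_le

lemma PotentialBdd.shift_le {s : Address} (hs : PotentialBdd s) (n : ℕ) :
    Finv^[n] |(shift 1 s n : ℝ)| ≤ F (supPotential s) := by
  have h := hs.le (1 + n)
  rw [add_comm 1 n, Function.iterate_succ_apply'] at h
  have h2 := F_strictMono.monotone h
  rw [F_Finv (Finv_iterate_nonneg n (abs_nonneg _))] at h2
  rwa [shift, add_comm 1 n]

lemma PotentialBdd.shift_one {s : Address} (hs : PotentialBdd s) : PotentialBdd (shift 1 s) :=
  ⟨F (supPotential s), by rintro _ ⟨n, rfl⟩; exact hs.shift_le n⟩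

lemma PotentialBdd.supPotential_shift_le {s : Address} (hs : PotentialBdd s) :
    supPotential (shift 1 s) ≤ F (supPotential s) := ciSup_le hs.shift_le

lemma shift_one_shift (n : ℕ) (s : Address) : shift 1 (shift n s) = shift (n + 1) s := by
  ext k; simp [shift, add_assoc]

lemma shift_zero (s : Address) : shift 0 s = s := by
  ext k; simp [shift]

lemma PotentialBdd.shift {s : Address} (hs : PotentialBdd s) (n : ℕ) :
    PotentialBdd (shift n s) := by
  induction n with
  | zero => rwa [shift_zero]
  | succ n ih => rw [← shift_one_shift]; exact ih.shift_one

lemma two_log_pos (κ : ℂ) : 0 < 2 * Real.log (‖κ‖ + 3) := by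
  have := Real.log_pos (show 1 < ‖κ‖ + 3 by linarith [norm_nonneg κ])
  linarith

lemma PotentialBdd.tailPotential_shift_le {s : Address} (hs : PotentialBdd s) (κ : ℂ) :
    tailPotential κ (ExpFamily.shift 1 s) ≤ F (tailPotential κ s) := by
  have h := F_add_le hs.nonneg (two_log_pos κ).le
  have h2 := le_F (2 * Real.log (‖κ‖ + 3))
  have h3 := hs.supPotential_shift_le
  unfold tailPotential
  linarith

lemma exp_tailPotential (κ : ℂ) (s : Address) :
    Real.exp (tailPotential κ s) = Real.exp (supPotential s) * (‖κ‖ + 3) ^ 2 := by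
  rw [tailPotential, Real.exp_add, mul_comm 2, Real.exp_mul, Real.exp_log (by positivity)]
  norm_num

/-! ### Estimates on ray tails -/

/-- The term `2 log (‖κ‖ + 3)` in the tail potential gives `exp τ` a factor `(‖κ‖ + 3) ^ 2`, which
beats the error of order `‖κ‖`. The error from `s 1` is absorbed by `exp (supPotential s)`. -/
lemma tail_ratio {κ z : ℂ} {s : Address} {τ : ℝ} (hκ : 1000 ≤ ‖κ‖) (hs : PotentialBdd s)
    (hτ : tailPotential κ s < τ)
    (hz : ‖z - (F τ : ℂ)‖ ≤ ‖κ‖ + 2 * Real.pi * |(s 1 : ℝ)| + 1 / 4) :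
    ‖z / (Real.exp τ : ℂ) - 1‖ ≤ (‖κ‖ + 9) * Real.exp (supPotential s - τ) ∧
      (‖κ‖ + 9) * Real.exp (supPotential s - τ) ≤ 1 / 100 := by
  have h1 : |(s 1 : ℝ)| ≤ F (supPotential s) := by simpa [shift] using hs.shift_le 0
  have hS := Real.one_le_exp hs.nonneg
  have hpi := Real.pi_lt_d2
  have hpi0 := Real.pi_pos
  have he := exp_tailPotential κ s ▸ Real.exp_lt_exp.2 hτ
  have hpos := Real.exp_pos τ
  have hposS := Real.exp_pos (supPotential s)
  rw [Real.exp_sub]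
  constructor
  · have hne : (Real.exp τ : ℂ) ≠ 0 := by exact_mod_cast hpos.ne'
    have h2 : z / (Real.exp τ : ℂ) - 1 = (z - (F τ : ℂ) - 1) / (Real.exp τ : ℂ) := by
      field_simp; push_cast [F]; ring
    rw [h2, norm_div, Complex.norm_real, Real.norm_of_nonneg hpos.le, ← mul_div_assoc]
    gcongr
    have h3 : ‖z - (F τ : ℂ) - 1‖ ≤ ‖z - (F τ : ℂ)‖ + 1 := by
      simpa using norm_sub_le (z - (F τ : ℂ)) 1
    have h4 : 2 * Real.pi * |(s 1 : ℝ)| ≤ 6.3 * (Real.exp (supPotential s) - 1) := by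
      have : 0 ≤ |(s 1 : ℝ)| := abs_nonneg _
      unfold F at h1
      nlinarith
    nlinarith
  · rw [← mul_div_assoc, div_le_iff₀ hpos]
    nlinarith

lemma norm_log_le_of_norm_sub_one_le {u : ℂ} (hu : ‖u - 1‖ ≤ 1 / 100) :
    ‖Complex.log u‖ ≤ 1 / 4 := by
  have := Complex.norm_log_one_add_half_le_self (z := u - 1) (by linarith)
  rw [add_sub_cancel] at this
  linarith

lemma norm_invBranch_sub_le {κ z : ℂ} {τ : ℝ} {j : ℤ}
    (hz : ‖z / (Real.exp τ : ℂ) - 1‖ ≤ 1 / 100) :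
    ‖invBranch κ j z - (τ - κ + 2 * (Real.pi : ℂ) * Complex.I * (j : ℂ))‖ ≤ 1 / 4 := by
  have hpos := Real.exp_pos τ
  have hne : (Real.exp τ : ℂ) ≠ 0 := by exact_mod_cast hpos.ne'
  set u := z / (Real.exp τ : ℂ) with hu
  have hu0 : u ≠ 0 := by
    intro h
    rw [h] at hz; norm_num at hz
  have hzu : z = (Real.exp τ : ℂ) * u := by rw [hu]; field_simp
  have := norm_log_le_of_norm_sub_one_le hz
  rw [invBranch, hzu, Complex.log_ofReal_mul hpos hu0, Real.log_exp]
  convert this using 2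
  ring

/-- The induction closes because the error one level up is small relative to `exp τ`. The logarithm
turns it into an error of at most 1/4, leaving only the translation in the last inverse branch. -/
lemma norm_tailApprox_sub_le {κ : ℂ} (hκ : 1000 ≤ ‖κ‖) (m : ℕ) {s : Address} {τ : ℝ}
    (hs : PotentialBdd s) (hτ : tailPotential κ s < τ) :
    ‖tailApprox κ m s τ - (τ : ℂ)‖ ≤ ‖κ‖ + 2 * Real.pi * |(s 0 : ℝ)| + 1 / 4 := by
  induction m generalizing s τ with
  | zero =>
    simp only [tailApprox, sub_self, norm_zero]
    have := Real.pi_pos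
    positivity
  | succ m ih =>
    have h1 := ih hs.shift_one ((hs.tailPotential_shift_le κ).trans_lt (F_strictMono hτ))
    obtain ⟨h2, h3⟩ := tail_ratio (z := tailApprox κ m (shift 1 s) (F τ)) hκ hs hτ
      (by simpa [shift] using h1)
    have h4 := norm_invBranch_sub_le (κ := κ) (j := s 0) (h2.trans h3)
    have h5 : ‖2 * (Real.pi : ℂ) * Complex.I * (s 0 : ℂ)‖ = 2 * Real.pi * |(s 0 : ℝ)| := by
      simp [abs_of_pos Real.pi_pos]
    have h6 : tailApprox κ (m + 1) s τ - (τ : ℂ) =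
        (tailApprox κ (m + 1) s τ - (τ - κ + 2 * (Real.pi : ℂ) * Complex.I * (s 0 : ℂ)))
          - κ + 2 * (Real.pi : ℂ) * Complex.I * (s 0 : ℂ) := by ring
    rw [h6, ← h5]
    refine (norm_add_le _ _).trans ?_
    have h7 := norm_sub_le
      (tailApprox κ (m + 1) s τ - (τ - κ + 2 * (Real.pi : ℂ) * Complex.I * (s 0 : ℂ))) κ
    change ‖tailApprox κ (m + 1) s τ - _‖ ≤ 1 / 4 at h4
    linarith

lemma tailApprox_shift_ratio {κ : ℂ} (hκ : 1000 ≤ ‖κ‖) (m : ℕ) {s : Address} {τ : ℝ}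
    (hs : PotentialBdd s) (hτ : tailPotential κ s < τ) :
    ‖tailApprox κ m (shift 1 s) (F τ) / (Real.exp τ : ℂ) - 1‖ ≤
        (‖κ‖ + 9) * Real.exp (supPotential s - τ) ∧
      (‖κ‖ + 9) * Real.exp (supPotential s - τ) ≤ 1 / 100 := by
  have h1 := norm_tailApprox_sub_le hκ m hs.shift_one
    ((hs.tailPotential_shift_le κ).trans_lt (F_strictMono hτ))
  exact tail_ratio hκ hs hτ (by simpa [shift] using h1)

lemma norm_tailApprox_succ_sub_le {κ : ℂ} (hκ : 1000 ≤ ‖κ‖) (m : ℕ) {s : Address} {τ : ℝ}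
    (hs : PotentialBdd s) (hτ : tailPotential κ s < τ) :
    ‖tailApprox κ (m + 1) s τ - (τ - κ + 2 * (Real.pi : ℂ) * Complex.I * (s 0 : ℂ))‖ ≤ 1 / 4 := by
  obtain ⟨h2, h3⟩ := tailApprox_shift_ratio hκ m hs hτ
  exact norm_invBranch_sub_le (h2.trans h3)

/-- By the chain rule the derivative is the one at the next level divided by `u`, which is close to
1. The error terms at least halve from level to level; as `(8/2 + 1) / 0.99 < 8`, the constant 8
reproduces itself. -/
lemma exists_hasDerivAt_tailApprox {κ : ℂ} (hκ : 1000 ≤ ‖κ‖) (m : ℕ) {s : Address} {τ : ℝ}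
    (hs : PotentialBdd s) (hτ : tailPotential κ s < τ) :
    ∃ D : ℂ, HasDerivAt (fun t : ℝ => tailApprox κ m s t) D τ ∧
      ‖D - 1‖ ≤ 8 * ((‖κ‖ + 9) * Real.exp (supPotential s - τ)) := by
  induction m generalizing s τ with
  | zero =>
    refine ⟨1, Complex.ofRealCLM.hasDerivAt, ?_⟩
    simp only [sub_self, norm_zero]
    positivity
  | succ m ih =>
    have hτ' := (hs.tailPotential_shift_le κ).trans_lt (F_strictMono hτ)
    obtain ⟨D, hD, hD1⟩ := ih hs.shift_one hτ'
    obtain ⟨h2, h3⟩ := tailApprox_shift_ratio hκ m hs hτ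
    have hpos := Real.exp_pos τ
    have hne : (Real.exp τ : ℂ) ≠ 0 := by exact_mod_cast hpos.ne'
    set A := tailApprox κ m (shift 1 s) (F τ) with hA
    set u := A / (Real.exp τ : ℂ) with hu
    have hAu : A = (Real.exp τ : ℂ) * u := by rw [hu]; field_simp
    have hu1 : ‖u - 1‖ ≤ 1 / 100 := h2.trans h3
    have hure : 99 / 100 ≤ u.re := by
      have := (abs_le.1 ((Complex.abs_re_le_norm (u - 1)).trans hu1)).1
      simp at this
      linarith
    have hun : 99 / 100 ≤ ‖u‖ := hure.trans (Complex.re_le_norm u)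
    have hu0 : u ≠ 0 := by
      intro h
      rw [h] at hun; norm_num at hun
    have hslit : A ∈ Complex.slitPlane := by
      refine Or.inl ?_
      rw [hAu, Complex.re_ofReal_mul]
      nlinarith
    have hF : HasDerivAt F (Real.exp τ) τ := (Real.hasDerivAt_exp τ).sub_const 1
    have h4 := ((hD.scomp τ hF).clog_real hslit).sub_const κ |>.add_const
      (2 * (Real.pi : ℂ) * Complex.I * (s 0 : ℂ))
    refine ⟨_, h4, ?_⟩
    have h5 : (Real.exp τ • D) / ((fun t : ℝ => tailApprox κ m (shift 1 s) t) ∘ F) τ = D / u := by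
      change (Real.exp τ • D) / A = D / u
      rw [hAu, Complex.real_smul]
      field_simp
    rw [h5]
    have h6 : D / u - 1 = ((D - 1) - (u - 1)) / u := by field_simp; ring
    rw [h6, norm_div, div_le_iff₀ (by linarith)]
    have h7 := norm_sub_le (D - 1) (u - 1)
    have h8 : Real.exp (supPotential (shift 1 s) - F τ) ≤ Real.exp (supPotential s - τ) / 2 := by
      rw [le_div_iff₀ (by norm_num), ← Real.exp_log (show (0 : ℝ) < 2 by norm_num), ← Real.exp_add]
      apply Real.exp_le_exp.2
      have h9 := hs.supPotential_shift_le
      have h10 := Real.log_two_lt_d9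
      have h11 : 2 < τ - supPotential s := by
        have : 1 < Real.log (‖κ‖ + 3) := by
          rw [Real.lt_log_iff_exp_lt (by positivity)]
          have := Real.exp_one_lt_d9
          linarith
        unfold tailPotential at hτ
        linarith
      have h12 := F_add_le hs.nonneg (show 0 ≤ τ - supPotential s by linarith)
      have h13 := Real.quadratic_le_exp_of_nonneg (show 0 ≤ τ - supPotential s by linarith)
      rw [add_sub_cancel] at h12
      unfold F at *
      nlinarith
    set c := (‖κ‖ + 9) * Real.exp (supPotential s - τ)
    have h14 : (‖κ‖ + 9) * Real.exp (supPotential (shift 1 s) - F τ) ≤ c / 2 := by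
      have := mul_le_mul_of_nonneg_left h8 (show 0 ≤ ‖κ‖ + 9 by positivity)
      simp only [c]
      linarith
    have hc : 0 ≤ c := by positivity
    nlinarith

/-- This difference form passes to the limit in `m`, so that the ray itself need not be
differentiated. -/
lemma norm_tailApprox_sub_sub_le {κ : ℂ} (hκ : 1000 ≤ ‖κ‖) (m : ℕ) {s : Address} {a b : ℝ}
    (hs : PotentialBdd s) (ha : tailPotential κ s < a) (hb : tailPotential κ s < b) :
    ‖tailApprox κ m s b - tailApprox κ m s a - ((b : ℂ) - a)‖ ≤ 1 / 2 * |b - a| := by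
  have key : ∀ x : ℝ, tailPotential κ s < x → ∃ D : ℂ,
      HasDerivAt (fun t : ℝ => tailApprox κ m s t - (t : ℂ)) D x ∧ ‖D‖ ≤ 1 / 2 := by
    intro x hx
    obtain ⟨D, hD, hD1⟩ := exists_hasDerivAt_tailApprox hκ m hs hx
    refine ⟨D - 1, hD.sub Complex.ofRealCLM.hasDerivAt, hD1.trans ?_⟩
    have := (tailApprox_shift_ratio hκ 0 hs hx).2
    linarith
  choose! D hD hD1 using key
  have := Convex.norm_image_sub_le_of_norm_hasDerivWithin_le (𝕜 := ℝ) (s := Ioi (tailPotential κ s))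
    (fun x hx => (hD x hx).hasDerivWithinAt) hD1 (convex_Ioi _) ha hb
  rw [Real.norm_eq_abs] at this
  rwa [show tailApprox κ m s b - tailApprox κ m s a - ((b : ℂ) - a) =
    tailApprox κ m s b - b - (tailApprox κ m s a - a) by ring]

/-- On its tail the ray `g_s^κ(t)` is close to `t - κ + 2πi s_1`. -/
lemma IsDynamicRay.norm_sub_le {κ : ℂ} {s : Address} {t₀ : ℝ} {γ : ℕ → ℝ → ℂ}
    (h : IsDynamicRay κ s t₀ γ) (hκ : 1000 ≤ ‖κ‖) (hs : PotentialBdd s) {n : ℕ} {τ : ℝ}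
    (hτ : F^[n] t₀ ≤ τ) (hτ' : tailPotential κ (shift n s) < τ) :
    ‖γ n τ + κ - (τ + 2 * (Real.pi : ℂ) * Complex.I * (s n : ℂ))‖ ≤ 1 / 4 := by
  have h1 := (tendsto_add_atTop_iff_nat 1).2 (h.tail n τ hτ hτ')
  have h2 := (h1.sub_const (τ - κ + 2 * (Real.pi : ℂ) * Complex.I * (s n : ℂ))).norm
  have h3 := le_of_tendsto h2 (Eventually.of_forall fun m =>
    norm_tailApprox_succ_sub_le hκ m (hs.shift n) hτ')
  rwa [show γ n τ + κ - (τ + 2 * (Real.pi : ℂ) * Complex.I * (s n : ℂ)) =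
    γ n τ - (τ - κ + 2 * (Real.pi : ℂ) * Complex.I * (s n : ℂ)) by ring]

/-- On its tail the ray `g_s^κ` is close to a translation. -/
lemma IsDynamicRay.norm_sub_sub_le {κ : ℂ} {s : Address} {t₀ : ℝ} {γ : ℕ → ℝ → ℂ}
    (h : IsDynamicRay κ s t₀ γ) (hκ : 1000 ≤ ‖κ‖) (hs : PotentialBdd s) {n : ℕ} {a b : ℝ}
    (ha : F^[n] t₀ ≤ a) (ha' : tailPotential κ (shift n s) < a)
    (hb : F^[n] t₀ ≤ b) (hb' : tailPotential κ (shift n s) < b) :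
    ‖γ n b - γ n a - ((b : ℂ) - a)‖ ≤ 1 / 2 * |b - a| := by
  have h2 := (((h.tail n b hb hb').sub (h.tail n a ha ha')).sub_const ((b : ℂ) - a)).norm
  exact le_of_tendsto h2 (Eventually.of_forall fun m =>
    norm_tailApprox_sub_sub_le hκ m (hs.shift n) ha' hb')

/-! ### Variation of the argument along curves -/

/-- On a longer interval, `cos x` and `cos (x + π) = -cos x` would both be nonnegative for all `x`
in an interval, so the cosine would vanish there. -/
lemma le_pi_of_cos_nonneg {p q : ℝ} (h : ∀ x ∈ Icc p q, 0 ≤ Real.cos x) : q - p ≤ Real.pi := by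
  by_contra! hlt
  have hpi := Real.pi_pos
  have key : ∀ ε, 0 ≤ ε → ε ≤ q - p - Real.pi → Real.cos (p + ε) = 0 := by
    intro ε h0 h1
    have h2 := h (p + ε) ⟨by linarith, by linarith⟩
    have h3 := h (p + ε + Real.pi) ⟨by linarith, by linarith⟩
    rw [Real.cos_add_pi] at h3
    linarith
  have h0 := key 0 le_rfl (by linarith)
  rw [add_zero] at h0
  set ε := min (q - p - Real.pi) 1 with hε
  have hε0 : 0 < ε := lt_min (by linarith) one_pos
  have hεπ : ε < Real.pi := (min_le_right _ _).trans_lt (by linarith [Real.pi_gt_three])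
  have h1 := key ε hε0.le (min_le_left _ _)
  rw [Real.cos_add, h0, zero_mul, zero_sub, neg_eq_zero] at h1
  rcases mul_eq_zero.1 h1 with h2 | h2
  · have := Real.sin_sq_add_cos_sq p
    rw [h2, h0] at this
    norm_num at this
  · exact (Real.sin_pos_of_pos_of_lt_pi hε0 hεπ).ne' h2

/-- If `exp ∘ θ` stays in a closed half-plane, then the imaginary part of `θ` varies by at
most `π`. -/
lemma abs_im_sub_le_pi {θ : ℝ → ℂ} {a b α : ℝ} (hab : a ≤ b) (hc : ContinuousOn θ (Icc a b))
    (h : ∀ x ∈ Icc a b, 0 ≤ Real.cos ((θ x).im - α)) :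
    |(θ b).im - (θ a).im| ≤ Real.pi := by
  have hf : ContinuousOn (fun x => (θ x).im - α) (uIcc a b) := by
    rw [uIcc_of_le hab]
    exact (Complex.continuous_im.comp_continuousOn hc).sub continuousOn_const
  have hiv := intermediate_value_uIcc hf
  have hcos : ∀ y ∈ uIcc ((θ a).im - α) ((θ b).im - α), 0 ≤ Real.cos y := by
    intro y hy
    obtain ⟨x, hx, rfl⟩ := hiv hy
    rw [uIcc_of_le hab] at hx
    exact h x hx
  rcases le_total ((θ a).im - α) ((θ b).im - α) with hle | hle
  · rw [uIcc_of_le hle] at hcos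
    have := le_pi_of_cos_nonneg hcos
    rw [abs_le]; constructor <;> linarith [Real.pi_pos]
  · rw [uIcc_of_ge hle] at hcos
    have := le_pi_of_cos_nonneg hcos
    rw [abs_le]; constructor <;> linarith [Real.pi_pos]

lemma abs_im_sub_le_pi_of_exp_re_nonneg {θ : ℝ → ℂ} {a b : ℝ} (hab : a ≤ b)
    (hc : ContinuousOn θ (Icc a b)) (h : ∀ x ∈ Icc a b, 0 ≤ (Complex.exp (θ x)).re) :
    |(θ b).im - (θ a).im| ≤ Real.pi := by
  refine abs_im_sub_le_pi (α := 0) hab hc fun x hx => ?_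
  have := h x hx
  rw [Complex.exp_re] at this
  rw [sub_zero]
  exact nonneg_of_mul_nonneg_right this (Real.exp_pos _)

lemma abs_im_sub_le_pi_of_exp_re_nonpos {θ : ℝ → ℂ} {a b : ℝ} (hab : a ≤ b)
    (hc : ContinuousOn θ (Icc a b)) (h : ∀ x ∈ Icc a b, (Complex.exp (θ x)).re ≤ 0) :
    |(θ b).im - (θ a).im| ≤ Real.pi := by
  refine abs_im_sub_le_pi (α := Real.pi) hab hc fun x hx => ?_
  have := h x hx
  rw [Complex.exp_re] at this
  rw [Real.cos_sub_pi]
  nlinarith [Real.exp_pos (θ x).re]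

lemma abs_im_sub_le_pi_of_exp_im_nonneg {θ : ℝ → ℂ} {a b : ℝ} (hab : a ≤ b)
    (hc : ContinuousOn θ (Icc a b)) (h : ∀ x ∈ Icc a b, 0 ≤ (Complex.exp (θ x)).im) :
    |(θ b).im - (θ a).im| ≤ Real.pi := by
  refine abs_im_sub_le_pi (α := Real.pi / 2) hab hc fun x hx => ?_
  have := h x hx
  rw [Complex.exp_im] at this
  rw [Real.cos_sub_pi_div_two]
  exact nonneg_of_mul_nonneg_right this (Real.exp_pos _)

lemma abs_im_sub_le_pi_of_exp_im_nonpos {θ : ℝ → ℂ} {a b : ℝ} (hab : a ≤ b)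
    (hc : ContinuousOn θ (Icc a b)) (h : ∀ x ∈ Icc a b, (Complex.exp (θ x)).im ≤ 0) :
    |(θ b).im - (θ a).im| ≤ Real.pi := by
  refine abs_im_sub_le_pi (α := -(Real.pi / 2)) hab hc fun x hx => ?_
  have := h x hx
  rw [Complex.exp_im] at this
  rw [sub_neg_eq_add, Real.cos_add_pi_div_two]
  nlinarith [Real.exp_pos (θ x).re]

/-! ### Curves with a pointwise Lipschitz bound -/

/-- Near `x`, on the right, `f` satisfies a Lipschitz bound with constant `L` at `x`. -/
def RightLipAt (f : ℝ → ℂ) (L x : ℝ) : Prop := ∀ᶠ y in 𝓝[>] x, ‖f y - f x‖ ≤ L * (y - x)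

lemma RightLipAt.mono {f : ℝ → ℂ} {L L' x : ℝ} (h : RightLipAt f L x) (hL : L ≤ L') :
    RightLipAt f L' x := by
  filter_upwards [h, self_mem_nhdsWithin] with y hy hxy
  have : x < y := hxy
  exact hy.trans (mul_le_mul_of_nonneg_right hL (by linarith))

/-- Continuous induction along the interval: the points satisfying the bound form a closed set which
can always be prolonged to the right. -/
lemma norm_sub_le_of_rightLipAt {f : ℝ → ℂ} {L a b : ℝ} (hab : a ≤ b)
    (hc : ContinuousOn f (Icc a b)) (h : ∀ x ∈ Ico a b, RightLipAt f L x) :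
    ‖f b - f a‖ ≤ L * (b - a) := by
  have hclosed : IsClosed ({x | ‖f x - f a‖ ≤ L * (x - a)} ∩ Icc a b) := by
    rw [inter_comm]
    have h1 : ContinuousOn (fun x => ‖f x - f a‖) (Icc a b) := (hc.sub continuousOn_const).norm
    have h2 : ContinuousOn (fun x => L * (x - a)) (Icc a b) := by fun_prop
    exact isClosed_Icc.isClosed_le h1 h2
  refine hclosed.Icc_subset_of_forall_exists_gt (by simp) ?_ ⟨hab, le_rfl⟩
  rintro x ⟨hx, hxab⟩ y hy
  have hy' : x < y := hy
  have h2 : ∀ᶠ z in 𝓝[>] x, z ∈ Ioc x y := Ioc_mem_nhdsGT hy'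
  obtain ⟨z, hz, hz2⟩ := ((h x hxab).and h2).exists
  refine ⟨z, ?_, hz2⟩
  have h3 := norm_sub_le_norm_sub_add_norm_sub (f z) (f x) (f a)
  change ‖f x - f a‖ ≤ L * (x - a) at hx
  change ‖f z - f a‖ ≤ L * (z - a)
  linarith

/-- Formally `g' = h'(F τ) exp τ / exp (g τ)`. The factor 2 exceeds the ratio of 5/4 and 3/4, the
linearization errors of the two exponentials. -/
lemma rightLipAt_of_exp {g h : ℝ → ℂ} {κ : ℂ} {τ L : ℝ} (hL : 0 ≤ L)
    (hg : ContinuousWithinAt g (Ioi τ) τ)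
    (he : ∀ x, τ ≤ x → Complex.exp (g x) = h (F x) - κ) (hh : RightLipAt h L (F τ)) :
    RightLipAt g (L * (2 * Real.exp τ / ‖Complex.exp (g τ)‖)) τ := by
  have hF : Tendsto F (𝓝[>] τ) (𝓝[>] (F τ)) := by
    refine tendsto_nhdsWithin_iff.2 ⟨?_, ?_⟩
    · have : Continuous F := Real.continuous_exp.sub continuous_const
      exact this.continuousWithinAt
    · filter_upwards [self_mem_nhdsWithin] with y hy using F_strictMono hy
  have h1 := hF.eventually hh
  have h2 : ∀ᶠ y in 𝓝[>] τ, ‖g y - g τ‖ < 1 / 4 := by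
    have := (Metric.tendsto_nhds.1 hg) (1 / 4) (by norm_num)
    simpa [dist_eq_norm] using this
  have h3 : ∀ᶠ y in 𝓝[>] τ, y ∈ Ioc τ (τ + 1 / 4) := Ioc_mem_nhdsGT (by linarith)
  filter_upwards [h1, h2, h3] with y hy1 hy2 hy3
  have hpos : 0 < ‖Complex.exp (g τ)‖ := by simp
  set u := g y - g τ
  set d := y - τ
  have hd0 : 0 < d := by simp only [d]; linarith [hy3.1]
  have hd1 : d ≤ 1 / 4 := by simp only [d]; linarith [hy3.2]
  have e1 : h (F y) - h (F τ) = Complex.exp (g τ) * (Complex.exp u - 1) := by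
    have := he y hy3.1.le
    have h4 := he τ le_rfl
    rw [mul_sub, ← Complex.exp_add, mul_one, add_sub_cancel, this, h4]; ring
  have e2 : F y - F τ = Real.exp τ * (Real.exp d - 1) := by
    rw [mul_sub, ← Real.exp_add, mul_one, add_sub_cancel, F, F]; ring
  have h5 : Real.exp d - 1 ≤ 5 / 4 * d := by
    have := (abs_le.1 (Real.abs_exp_sub_one_sub_id_le (x := d) (by rw [abs_le]; constructor <;> linarith))).2
    nlinarith
  have h6 : 3 / 4 * ‖u‖ ≤ ‖Complex.exp u - 1‖ := by
    have h7 := Complex.norm_exp_sub_one_sub_id_le (x := u) (by linarith)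
    have h8 := norm_sub_norm_le u (u - (Complex.exp u - 1))
    rw [sub_sub_cancel, norm_sub_rev u] at h8
    nlinarith [norm_nonneg u]
  rw [e1, e2, norm_mul] at hy1
  have h9 : L * (2 * Real.exp τ / ‖Complex.exp (g τ)‖) * d =
    (2 * L * Real.exp τ * d) / ‖Complex.exp (g τ)‖ := by ring
  rw [h9, le_div_iff₀ hpos]
  have h10 : L * (Real.exp τ * (Real.exp d - 1)) ≤ L * (Real.exp τ * (5 / 4 * d)) := by gcongr
  have h11 := mul_le_mul_of_nonneg_left h6 hpos.le
  have h12 : 0 ≤ L * Real.exp τ * d := by positivity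
  nlinarith

/-! ### Orbits of `w ↦ exp w + κ` -/

lemma norm_exp_sub_exp_le {a b : ℂ} (h : ‖b - a‖ ≤ 1) :
    ‖Complex.exp b - Complex.exp a‖ ≤ 2 * ‖Complex.exp a‖ * ‖b - a‖ := by
  have h1 : Complex.exp b - Complex.exp a = Complex.exp a * (Complex.exp (b - a) - 1) := by
    rw [mul_sub, ← Complex.exp_add, mul_one, add_sub_cancel]
  rw [h1, norm_mul]
  have := mul_le_mul_of_nonneg_left (Complex.norm_exp_sub_one_le h) (norm_nonneg (Complex.exp a))
  linarith

/-- The derivative along an orbit `z` of `w ↦ exp w + κ` is bounded below in terms of the distance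
of its last point to the orbit `w` of the singular value `κ`. -/
lemma prod_norm_exp_ge {κ : ℂ} {z w : ℕ → ℂ} (hz : ∀ i, Complex.exp (z i) = z (i + 1) - κ)
    (hw : ∀ i, Complex.exp (w i) = w (i + 1) - κ) (hw0 : w 0 = κ) (j : ℕ) {δ : ℝ} (hδ1 : δ ≤ 1)
    (hδ : ∀ k < j, δ ≤ ‖z j - w k‖) :
    δ / 2 ^ j ≤ ∏ i ∈ Finset.range j, ‖Complex.exp (z i)‖ := by
  induction j generalizing δ with
  | zero => simpa using hδ1
  | succ j ih =>
    have ha : 0 < ‖Complex.exp (z j)‖ := by simp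
    have haδ : δ ≤ ‖Complex.exp (z j)‖ := by
      have := hδ 0 (Nat.succ_pos j)
      rwa [hw0, ← hz] at this
    -- One step of `exp` multiplies distances below 1 by at most `2 ‖exp (z j)‖`, so separation `δ`
    -- after the step forces this separation before it. The case `k = 0` is `haδ`, which covers the
    -- value 1 of the minimum.
    have h1 := ih (δ := min 1 (δ / (2 * ‖Complex.exp (z j)‖))) (min_le_left _ _) (by
      intro k hk
      rcases le_total 1 ‖z j - w k‖ with h | h
      · exact (min_le_left _ _).trans h
      · refine (min_le_right _ _).trans ?_
        rw [div_le_iff₀ (by positivity)]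
        have h2 := hδ (k + 1) (by omega)
        have h3 := norm_exp_sub_exp_le (a := z j) (b := w k) (by rwa [norm_sub_rev])
        rw [hz, hw, sub_sub_sub_cancel_right, norm_sub_rev, norm_sub_rev (w k), ← hz] at h3
        linarith)
    rw [Finset.prod_range_succ]
    refine le_trans ?_ (mul_le_mul_of_nonneg_right h1 ha.le)
    rw [pow_succ, div_mul_eq_mul_div, ← div_div, div_right_comm]
    gcongr
    rcases le_total δ 0 with hneg | hpos
    · rw [min_eq_right (le_trans (div_nonpos_of_nonpos_of_nonneg hneg (by positivity)) zero_le_one)]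
      rw [div_mul_eq_mul_div, le_div_iff₀ (by positivity)]
      linarith
    · rw [min_mul_of_nonneg _ _ ha.le, le_min_iff]
      constructor
      · linarith
      · rw [div_mul_eq_mul_div, le_div_iff₀ (by positivity)]
        linarith

/-- The dynamic rays `Γ n` of the addresses `σ^n s` for the map `w ↦ exp w + κ`, where `Γ 0` meets
the singular value `κ` at the potential `t`, and where `Γ n` is nearly horizontal beyond the
potential `T n`. The parameter `ℓ` bounds the potentials `T n` for all levels `n` at which the
singular orbit has not yet reached these tails, and the number of these levels. -/
structure SingularRay (κ : ℂ) (t ℓ : ℝ) (T : ℕ → ℝ) (s : ℕ → ℤ) (Γ : ℕ → ℝ → ℂ) : Prop where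
  norm_ge : 1000 ≤ ‖κ‖
  t_nonneg : 0 ≤ t
  le_ell : 100 ≤ ℓ
  continuousOn : ∀ n, ContinuousOn (Γ n) (Ici (F^[n] t))
  exp_eq : ∀ n τ, F^[n] t ≤ τ → Complex.exp (Γ n τ) = Γ (n + 1) (F τ) - κ
  tail_near : ∀ n τ, F^[n] t ≤ τ → T n < τ →
    ‖Γ n τ - (τ + 2 * (Real.pi : ℂ) * Complex.I * (s n : ℂ))‖ ≤ 1 / 4
  tail_sub : ∀ n a b, F^[n] t ≤ a → T n < a → F^[n] t ≤ b → T n < b →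
    ‖Γ n b - Γ n a - ((b : ℂ) - a)‖ ≤ 1 / 2 * |b - a|
  T_succ : ∀ n, T (n + 1) ≤ F (T n)
  abs_le_T : ∀ n, |(s n : ℝ)| ≤ T n
  le_exp_T : ∀ n, (‖κ‖ + 3) ^ 2 ≤ Real.exp (T n)
  bad : ∀ n, F^[n] t ≤ T n → T n ≤ ℓ ∧ (n : ℝ) + 1 ≤ ℓ
  start : Γ 0 t = κ
  start_bad : t ≤ T 0

namespace SingularRay

variable {κ : ℂ} {t ℓ : ℝ} {T : ℕ → ℝ} {s : ℕ → ℤ} {Γ : ℕ → ℝ → ℂ}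

lemma T_nonneg (h : SingularRay κ t ℓ T s Γ) (n : ℕ) : 0 ≤ T n :=
  (abs_nonneg _).trans (h.abs_le_T n)

lemma two_lt_T (h : SingularRay κ t ℓ T s Γ) (n : ℕ) : 2 < T n := by
  rw [← Real.exp_lt_exp]
  have h1 := h.le_exp_T n
  have h2 := h.norm_ge
  have h3 : Real.exp 2 < 9 := by
    rw [show (2 : ℝ) = 1 + 1 by norm_num, Real.exp_add]
    nlinarith [Real.exp_one_lt_d9, Real.exp_pos 1]
  nlinarith

lemma iterate_succ_le {n : ℕ} {τ : ℝ} (hτ : F^[n] t ≤ τ) : F^[n + 1] t ≤ F τ := by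
  rw [Function.iterate_succ_apply']
  exact F_strictMono.monotone hτ

lemma T_succ_lt (h : SingularRay κ t ℓ T s Γ) {n : ℕ} {τ : ℝ} (hτ : T n < τ) :
    T (n + 1) < F τ := (h.T_succ n).trans_lt (F_strictMono hτ)

/-- There is a first level at which the singular orbit has reached the tail. -/
lemma exists_level (h : SingularRay κ t ℓ T s Γ) :
    ∃ N : ℕ, 1 ≤ N ∧ (N : ℝ) ≤ ℓ ∧ (∀ n < N, F^[n] t ≤ T n) ∧ ∀ n, N ≤ n → T n < F^[n] t := by
  classical
  have hex : ∃ n : ℕ, T n < F^[n] t := by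
    obtain ⟨n, hn⟩ := exists_nat_gt ℓ
    refine ⟨n, ?_⟩
    by_contra! hle
    have := (h.bad n hle).2
    linarith
  have hlt : ∀ n < Nat.find hex, F^[n] t ≤ T n := fun n hn => not_lt.1 (Nat.find_min hex hn)
  have h1 : 1 ≤ Nat.find hex := by
    rw [Nat.one_le_iff_ne_zero, Ne, Nat.find_eq_zero]
    exact not_lt.2 h.start_bad
  refine ⟨Nat.find hex, h1, ?_, hlt, ?_⟩
  · have := (h.bad _ (hlt (Nat.find hex - 1) (by omega))).2
    rw [Nat.cast_sub h1] at this
    simpa using this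
  · intro n hn
    induction n, hn using Nat.le_induction with
    | base => exact Nat.find_spec hex
    | succ n _ ih =>
      rw [Function.iterate_succ_apply']
      exact h.T_succ_lt ih

lemma abs_re_sub_le (h : SingularRay κ t ℓ T s Γ) {n : ℕ} {τ : ℝ} (hτ : F^[n] t ≤ τ)
    (hT : T n < τ) : |(Γ n τ).re - τ| ≤ 1 / 4 := by
  have := (Complex.abs_re_le_norm _).trans (h.tail_near n τ hτ hT)
  simpa using this

lemma abs_im_le (h : SingularRay κ t ℓ T s Γ) {n : ℕ} {τ : ℝ} (hτ : F^[n] t ≤ τ)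
    (hT : T n < τ) : |(Γ n τ).im| ≤ 6.3 * T n + 1 / 4 := by
  have h1 := (Complex.abs_im_le_norm _).trans (h.tail_near n τ hτ hT)
  have h2 : |(Γ n τ).im - 2 * Real.pi * (s n : ℝ)| ≤ 1 / 4 := by simpa using h1
  have h3 := abs_le.1 h2
  have h4 := h.abs_le_T n
  have h5 : |2 * Real.pi * (s n : ℝ)| ≤ 6.3 * T n := by
    rw [abs_mul, abs_of_pos (by positivity : 0 < 2 * Real.pi)]
    have := Real.pi_lt_d2
    have := Real.pi_pos
    nlinarith [abs_nonneg (s n : ℝ)]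
  have h6 := abs_le.1 h5
  rw [abs_le]
  constructor <;> linarith

lemma exp_iterate (h : SingularRay κ t ℓ T s Γ) {n : ℕ} {τ : ℝ} (hτ : F^[n] t ≤ τ) (i : ℕ) :
    F^[n + i] t ≤ F^[i] τ ∧
      Complex.exp (Γ (n + i) (F^[i] τ)) = Γ (n + (i + 1)) (F^[i + 1] τ) - κ := by
  have h1 : F^[n + i] t ≤ F^[i] τ := by
    rw [add_comm, Function.iterate_add_apply]
    exact (F_iterate_strictMono i).monotone hτ
  refine ⟨h1, ?_⟩
  rw [h.exp_eq _ _ h1, Function.iterate_succ_apply', add_assoc]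

lemma exp_singular (h : SingularRay κ t ℓ T s Γ) (k : ℕ) :
    Complex.exp (Γ k (F^[k] t)) = Γ (k + 1) (F^[k + 1] t) - κ := by
  rw [h.exp_eq k _ le_rfl, Function.iterate_succ_apply']

lemma F_ge_add_one {y : ℝ} (hy : 2 ≤ y) : y + 1 ≤ F y := by
  have := Real.quadratic_le_exp_of_nonneg (show 0 ≤ y by linarith)
  unfold F
  nlinarith

/-! ### Lower bound for `Re κ` and bound for `|Im κ|` -/

/-- If `Re κ < -2`, then the singular value is attracted to a fixed point. -/
lemma neg_two_le_re (h : SingularRay κ t ℓ T s Γ) : -2 ≤ κ.re := by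
  by_contra! hlt
  have key : ∀ k, (Γ k (F^[k] t)).re ≤ -1 := by
    intro k
    induction k with
    | zero => simp only [Function.iterate_zero, id, h.start]; linarith
    | succ k ih =>
      have h1 := congrArg Complex.re (h.exp_singular k)
      have h2 := Complex.re_le_norm (Complex.exp (Γ k (F^[k] t)))
      rw [Complex.norm_exp] at h2
      have h3 : Real.exp (Γ k (F^[k] t)).re ≤ 1 := Real.exp_le_one_iff.2 (by linarith)
      rw [Complex.sub_re] at h1
      linarith
  obtain ⟨N, -, -, -, hN⟩ := h.exists_level
  have h1 := (abs_le.1 (h.abs_re_sub_le le_rfl (hN N le_rfl))).1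
  have h2 := key N
  have h3 := h.T_nonneg N
  have h4 := hN N le_rfl
  linarith

/-- On a tail, the lift of the next ray varies by at most `2 π` in the imaginary direction. -/
lemma abs_im_sub_le_of_tail (h : SingularRay κ t ℓ T s Γ) {n : ℕ} {c b : ℝ} (hc : F^[n] t ≤ c)
    (hcb : c ≤ b) (hT : ∀ x, c < x → T (n + 1) < F x) :
    |(Γ n b).im - (Γ n c).im| ≤ 2 * Real.pi := by
  have hpi := Real.pi_pos
  have hcont : ∀ {x y}, c ≤ x → ContinuousOn (Γ n) (Icc x y) := fun hx =>
    (h.continuousOn n).mono fun z hz => hc.trans (hx.trans hz.1)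
  set g : ℝ → ℝ := fun x => (Complex.exp (Γ n x)).re with hg
  have hgc : ContinuousOn g (Icc c b) :=
    Complex.continuous_re.comp_continuousOn (Complex.continuous_exp.comp_continuousOn
      (hcont le_rfl))
  -- The image lies in a tail, which is a translation up to a factor 1/2, so its real part
  -- increases.
  have hmono' : ∀ x y, c < x → x ≤ y → g x ≤ g y := by
    intro x y hx hxy
    have h1 := h.tail_sub (n + 1) (F x) (F y) (iterate_succ_le (hc.trans hx.le)) (hT x hx)
      (iterate_succ_le (hc.trans (hx.le.trans hxy))) (hT y (hx.trans_le hxy))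
    have h2 := (Complex.abs_re_le_norm _).trans h1
    have h3 : F x ≤ F y := F_strictMono.monotone hxy
    rw [abs_of_nonneg (by linarith : 0 ≤ F y - F x)] at h2
    have h4 := (abs_le.1 h2).1
    simp only [hg, h.exp_eq n x (hc.trans hx.le), h.exp_eq n y (hc.trans (hx.le.trans hxy)),
      Complex.sub_re, Complex.ofReal_re] at h4 ⊢
    linarith
  have hmono : ∀ x y, c ≤ x → x ≤ y → y ≤ b → g x ≤ g y := by
    intro x y hx hxy hyb
    rcases hx.lt_or_eq with hlt | rfl
    · exact hmono' x y hlt hxy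
    · rcases hxy.lt_or_eq with hlt | rfl
      · have h1 : Tendsto g (𝓝[Ioc c y] c) (𝓝 (g c)) :=
          (hgc c ⟨le_rfl, hcb⟩).mono_left (nhdsWithin_mono _ fun z hz => ⟨hz.1.le, hz.2.trans hyb⟩)
        have : (𝓝[Ioc c y] c).NeBot := by
          rw [nhdsWithin_Ioc_eq_nhdsGT hlt]; infer_instance
        refine le_of_tendsto h1 ?_
        filter_upwards [self_mem_nhdsWithin] with z hz using hmono' z y hz.1 hz.2
      · exact le_rfl
  -- A monotone real part changes sign at most once; each half-plane contributes at most `π`.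
  rcases le_total (g b) 0 with hb | hb
  · have := abs_im_sub_le_pi_of_exp_re_nonpos hcb (hcont le_rfl)
      fun x hx => (hmono x b hx.1 hx.2 le_rfl).trans hb
    linarith
  rcases le_total 0 (g c) with hc0 | hc0
  · have := abs_im_sub_le_pi_of_exp_re_nonneg hcb (hcont le_rfl)
      fun x hx => hc0.trans (hmono c x le_rfl hx.1 hx.2)
    linarith
  obtain ⟨e, he, he0⟩ := intermediate_value_Icc hcb hgc ⟨hc0, hb⟩
  have h1 := abs_im_sub_le_pi_of_exp_re_nonpos he.1 (hcont le_rfl)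
      fun x hx => (hmono x e hx.1 hx.2 he.2).trans he0.le
  have h2 := abs_im_sub_le_pi_of_exp_re_nonneg he.2 (hcont he.1)
      fun x hx => he0.ge.trans (hmono e x he.1 hx.1 hx.2)
  have h3 := abs_sub_le (Γ n b).im (Γ n e).im (Γ n c).im
  linarith

/-- If `|Im κ|` were larger, downward induction on the level would bound the imaginary parts of all
points outside the tails, including `Γ 0 t = κ`. While the next ray is outside its tail, `exp (Γ n)
= Γ (n + 1) - κ` stays in one half-plane, so `Im (Γ n)` turns by at most `π`; once it is in its
tail, by at most `2π`. -/
lemma abs_im_kappa_le (h : SingularRay κ t ℓ T s Γ) : |κ.im| ≤ 7 * ℓ + 10 := by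
  by_contra! hlt
  obtain ⟨N, hN1, -, hNbad, hN⟩ := h.exists_level
  have key : ∀ q n, N ≤ n + q → ∀ τ, F^[n] t ≤ τ → τ ≤ T n → |(Γ n τ).im| ≤ 7 * ℓ + 10 := by
    intro q
    induction q with
    | zero =>
      intro n hn τ h1 h2
      have := hN n (by omega)
      linarith
    | succ q ih =>
      intro n hn τ h1 h2
      have hpi := Real.pi_lt_d2
      have hbad := (h.bad n (h1.trans h2)).1
      have hT1 := h.T_nonneg (n + 1)
      set b := T n + 1 with hb
      -- Beyond `c` the image under `F` lies in the tail of level `n + 1`.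
      set c := max τ (Finv (T (n + 1))) with hc
      have hcb : c ≤ b := by
        refine max_le (by linarith) ?_
        rw [← F_strictMono.le_iff_le, F_Finv hT1]
        exact (h.T_succ n).trans (F_strictMono.monotone (by linarith))
      have hτc : τ ≤ c := le_max_left _ _
      have e1 := h.abs_im_sub_le_of_tail (h1.trans hτc) hcb (by
        intro x hx
        rw [← F_Finv hT1]
        exact F_strictMono ((le_max_right _ _).trans_lt hx))
      have e2 : |(Γ n c).im - (Γ n τ).im| ≤ Real.pi := by
        rcases hτc.eq_or_lt with heq | hlt'
        · rw [← heq]; simp [Real.pi_pos.le]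
        have hcF : F c = T (n + 1) := by
          have : c = Finv (T (n + 1)) := by
            rcases max_choice τ (Finv (T (n + 1))) with h3 | h3
            · rw [hc, h3] at hlt'; exact absurd hlt' (lt_irrefl _)
            · exact h3
          rw [this, F_Finv hT1]
        have hcont : ContinuousOn (Γ n) (Icc τ c) :=
          (h.continuousOn n).mono fun z hz => h1.trans hz.1
        have him : ∀ x ∈ Icc τ c, |(Complex.exp (Γ n x)).im + κ.im| ≤ 7 * ℓ + 10 := by
          intro x hx
          have h3 := ih (n + 1) (by omega) (F x) (iterate_succ_le (h1.trans hx.1))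
            (hcF ▸ F_strictMono.monotone hx.2)
          rw [h.exp_eq n x (h1.trans hx.1), Complex.sub_im, sub_add_cancel]
          exact h3
        rcases le_total 0 κ.im with hsgn | hsgn
        · rw [abs_of_nonneg hsgn] at hlt
          refine abs_im_sub_le_pi_of_exp_im_nonpos hτc hcont fun x hx => ?_
          have := (abs_le.1 (him x hx)).2
          linarith
        · rw [abs_of_nonpos hsgn] at hlt
          refine abs_im_sub_le_pi_of_exp_im_nonneg hτc hcont fun x hx => ?_
          have := (abs_le.1 (him x hx)).1
          linarith
      have e3 := h.abs_im_le (n := n) (τ := b) (by linarith) (by linarith)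
      rw [abs_le] at *
      constructor <;> linarith
  have h1 := key N 0 (by omega) t le_rfl h.start_bad
  rw [h.start] at h1
  linarith

/-- The singular orbit enters the tail at a moderate place. -/
lemma norm_singular_level_le (h : SingularRay κ t ℓ T s Γ) {N : ℕ} (hN1 : 1 ≤ N)
    (hNbad : ∀ n < N, F^[n] t ≤ T n) (hN : T N < F^[N] t) :
    ‖Γ N (F^[N] t)‖ ≤ 8 * Real.exp ℓ := by
  obtain ⟨n, rfl⟩ := Nat.exists_eq_add_of_le' hN1
  have hb := hNbad n (by omega)
  have hT := (h.bad n hb).1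
  have h1 : F^[n + 1] t ≤ F ℓ := iterate_succ_le (hb.trans hT)
  have h2 : T (n + 1) ≤ F ℓ := (h.T_succ n).trans (F_strictMono.monotone hT)
  have h3 := Complex.norm_le_abs_re_add_abs_im (Γ (n + 1) (F^[n + 1] t))
  have h4 := h.abs_im_le le_rfl hN
  have h5 := abs_le.1 (h.abs_re_sub_le le_rfl hN)
  have h6 := h.T_nonneg (n + 1)
  have h7 : |(Γ (n + 1) (F^[n + 1] t)).re| ≤ F ℓ + 1 / 4 := by
    rw [abs_le]; constructor <;> linarith
  unfold F at *
  have := Real.exp_pos ℓ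
  linarith

/-! ### Separation from the singular orbit and Lipschitz bounds for rays -/

/-- Points on tails keep a definite distance from the earlier points of the singular orbit. -/
lemma separation (h : SingularRay κ t ℓ T s Γ) {N : ℕ} (hN1 : 1 ≤ N)
    (hNbad : ∀ n < N, F^[n] t ≤ T n) (hN : ∀ n, N ≤ n → T n < F^[n] t) {Y G : ℝ}
    (hY : ∀ k ≤ N, ‖Γ k (F^[k] t)‖ ≤ Y) (hG : 3 * (32 * Real.exp ℓ + 4 * Real.log (2 * Y)) ≤ G)
    (q k : ℕ) (hkq : N ≤ k + q) {m : ℕ} (hkm : k < m) {u : ℝ} (hu : F^[m] t ≤ u) (hTu : T m < u) :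
    1 / 4 / G ^ q ≤ ‖Γ m u - Γ k (F^[k] t)‖ := by
  have hκY : ‖κ‖ ≤ Y := by simpa [h.start] using hY 0 (by omega)
  have hK := h.norm_ge
  have hlogY : 0 ≤ Real.log (2 * Y) := Real.log_nonneg (by linarith)
  have hG1 : 1 ≤ G := by
    have := Real.one_le_exp (show 0 ≤ ℓ by linarith [h.le_ell])
    linarith
  have hsmall : ∀ q : ℕ, 1 / 4 / G ^ q ≤ 1 / 4 := fun q =>
    div_le_self (by norm_num) (one_le_pow₀ hG1)
  have hbase : N ≤ k → 1 / 4 ≤ ‖Γ m u - Γ k (F^[k] t)‖ := by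
    intro hk
    have hTk := hN k hk
    have h1 := abs_le.1 (h.abs_re_sub_le le_rfl hTk)
    have h2 := abs_le.1 (h.abs_re_sub_le hu hTu)
    have h3 := F_ge_add_one ((h.two_lt_T k).trans hTk).le
    have h4 : F (F^[k] t) ≤ u := by
      rw [← Function.iterate_succ_apply' F]
      exact (F_iterate_le_iterate hkm t).trans hu
    refine le_trans ?_ (Complex.re_le_norm _)
    rw [Complex.sub_re]
    linarith
  induction q generalizing k m u with
  | zero => exact (hsmall 0).trans (hbase (by omega))
  | succ q ih =>
    rcases le_or_gt N k with hk | hk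
    · exact (hsmall _).trans (hbase hk)
    by_contra! hlt
    set v := Γ k (F^[k] t) - Γ m u with hv
    have hv4 : ‖v‖ < 1 / 4 / G ^ (q + 1) := by rwa [hv, norm_sub_rev]
    have hv1 : ‖v‖ < 1 / 4 := hv4.trans_le (hsmall _)
    have hIH := ih (k + 1) (by omega) (m := m + 1) (by omega) (u := F u) (iterate_succ_le hu)
      (h.T_succ_lt hTu) (by
        intro hk'
        have hTk := hN (k + 1) hk'
        have h1 := abs_le.1 (h.abs_re_sub_le le_rfl hTk)
        have h2 := abs_le.1 (h.abs_re_sub_le (iterate_succ_le hu) (h.T_succ_lt hTu))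
        have h3 := F_ge_add_one ((h.two_lt_T (k + 1)).trans hTk).le
        have h4 : F (F^[k + 1] t) ≤ F u := by
          rw [← Function.iterate_succ_apply' F]
          exact (F_iterate_le_iterate (by omega) t).trans (iterate_succ_le hu)
        refine le_trans ?_ (Complex.re_le_norm _)
        rw [Complex.sub_re]
        linarith)
    have hexpu := Real.exp_pos u
    have hX : ‖Complex.exp (Γ m u)‖ ≤ 4 / 3 * Real.exp u := by
      rw [Complex.norm_exp]
      have h1 := abs_le.1 (h.abs_re_sub_le hu hTu)
      have h2 : Real.exp (Γ m u).re ≤ Real.exp (u + 1 / 4) := Real.exp_le_exp.2 (by linarith)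
      have h3 := Real.add_one_le_exp (-(1 / 4 : ℝ))
      have h4 : Real.exp (u + 1 / 4) * Real.exp (-(1 / 4)) = Real.exp u := by
        rw [← Real.exp_add]; congr 1; ring
      have h5 := Real.exp_pos (u + 1 / 4)
      nlinarith
    have hdiff := norm_exp_sub_exp_le (a := Γ m u) (b := Γ k (F^[k] t)) (by linarith)
    -- Closeness to `Γ m u` makes `Re (w (k+1))` at least `exp u / 4`. Then either `w (k+2)` would
    -- have modulus of order `exp (exp u / 4)`, which `Y` limits, or `k + 1 = N` and `w N` is
    -- moderate.
    have heG : 3 * Real.exp u ≤ G := by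
      have hre : Real.exp u / 4 ≤ (Γ (k + 1) (F^[k + 1] t)).re := by
        have h1 := abs_le.1 (h.abs_re_sub_le (iterate_succ_le hu) (h.T_succ_lt hTu))
        have h2 := congrArg Complex.re (h.exp_eq m u hu)
        have h3 := congrArg Complex.re (h.exp_singular k)
        have h4 := (abs_le.1 ((Complex.abs_re_le_norm _).trans hdiff)).1
        have h5 := (h.le_exp_T m).trans (Real.exp_le_exp.2 hTu.le)
        have h6 := abs_le.1 (Complex.abs_re_le_norm κ)
        rw [Complex.sub_re] at h2 h3 h4
        have h7 : 2 * ‖Complex.exp (Γ m u)‖ * ‖Γ k (F^[k] t) - Γ m u‖ ≤ 2 / 3 * Real.exp u := by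
          have : 2 * ‖Complex.exp (Γ m u)‖ * ‖v‖ ≤ 2 * (4 / 3 * Real.exp u) * (1 / 4) := by
            gcongr
          linarith
        unfold F at *
        nlinarith
      rcases Nat.lt_or_ge (k + 1) N with hkN | hkN
      · have h1 : Real.exp (Real.exp u / 4) ≤ 2 * Y := by
          have h2 := hY (k + 2) (by omega)
          have h3 := congrArg norm (h.exp_singular (k + 1))
          rw [Complex.norm_exp] at h3
          have h4 := norm_sub_le (Γ (k + 1 + 1) (F^[k + 1 + 1] t)) κ
          have h5 := Real.exp_le_exp.2 hre
          linarith
        rw [← Real.le_log_iff_exp_le (by linarith)] at h1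
        have := Real.exp_pos ℓ
        linarith
      · have hkN' : k + 1 = N := by omega
        have h1 := h.norm_singular_level_le hN1 hNbad (hN N le_rfl)
        rw [hkN'] at hre
        have h2 := Complex.re_le_norm (Γ N (F^[N] t))
        linarith
    rw [norm_sub_rev, ← sub_sub_sub_cancel_right _ _ κ, ← h.exp_singular k,
      ← h.exp_eq m u hu] at hIH
    have h1 : 1 / 4 / G ^ q ≤ G * ‖v‖ := by
      refine hIH.trans (hdiff.trans ?_)
      have : 2 * ‖Complex.exp (Γ m u)‖ * ‖v‖ ≤ 2 * (4 / 3 * Real.exp u) * ‖v‖ := by gcongr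
      have h2 : 3 * Real.exp u * ‖v‖ ≤ G * ‖v‖ := by gcongr
      have h3 := norm_nonneg v
      nlinarith
    rw [div_le_iff₀ (by positivity)] at h1
    rw [lt_div_iff₀ (by positivity), pow_succ] at hv4
    linarith

/-- The local Lipschitz constant of a ray at a point which reaches the tail after `j` steps. -/
lemma rightLipAt_prod (h : SingularRay κ t ℓ T s Γ) (j : ℕ) {n : ℕ} {τ : ℝ} (hτ : F^[n] t ≤ τ)
    (hT : T (n + j) < F^[j] τ) :
    RightLipAt (Γ n) (3 / 2 * ∏ i ∈ Finset.range j,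
      (2 * Real.exp (F^[i] τ) / ‖Complex.exp (Γ (n + i) (F^[i] τ))‖)) τ := by
  induction j generalizing n τ with
  | zero =>
    simp only [add_zero, Function.iterate_zero, id] at hT
    filter_upwards [self_mem_nhdsWithin] with y hy
    have hy' : τ < y := hy
    have h1 := h.tail_sub n τ y hτ hT (hτ.trans hy'.le) (hT.trans hy')
    have h2 := norm_sub_norm_le (Γ n y - Γ n τ) ((y : ℂ) - τ)
    have h3 : ‖(y : ℂ) - τ‖ = y - τ := by
      rw [← Complex.ofReal_sub, Complex.norm_real, Real.norm_of_nonneg (by linarith)]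
    rw [abs_of_pos (by linarith : 0 < y - τ)] at h1
    simp only [Finset.range_zero, Finset.prod_empty]
    linarith
  | succ j ih =>
    have h1 := ih (n := n + 1) (τ := F τ) (iterate_succ_le hτ) (by
      rw [← Function.iterate_succ_apply]
      convert hT using 2
      omega)
    have h2 := rightLipAt_of_exp (g := Γ n) (κ := κ) (by positivity)
      (((h.continuousOn n) τ hτ).mono fun x hx => hτ.trans (le_of_lt hx))
      (fun x hx => h.exp_eq n x (hτ.trans hx)) h1
    convert h2 using 1
    rw [Finset.prod_range_succ', mul_assoc]
    simp only [Function.iterate_succ_apply, Function.iterate_zero, id, add_zero]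
    congr 3
    ext i
    rw [add_right_comm, add_assoc]

/-- Follow the point until its first tail level `j`. Each step costs `2 exp ℓ` in the numerator and
2 in `prod_norm_exp_ge`; `separation` supplies `δ = 1 / (4 G ^ N)`, whence `6 = 3/2 * 4`. -/
lemma rightLipAt (h : SingularRay κ t ℓ T s Γ) {N : ℕ} (hN1 : 1 ≤ N)
    (hNbad : ∀ n < N, F^[n] t ≤ T n) (hN : ∀ n, N ≤ n → T n < F^[n] t) {Y G : ℝ}
    (hY : ∀ k ≤ N, ‖Γ k (F^[k] t)‖ ≤ Y) (hG : 3 * (32 * Real.exp ℓ + 4 * Real.log (2 * Y)) ≤ G)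
    {n : ℕ} {τ : ℝ} (hτ : F^[n] t ≤ τ) :
    RightLipAt (Γ n) (6 * (4 * Real.exp ℓ * G) ^ N) τ := by
  classical
  have hκY : ‖κ‖ ≤ Y := by simpa [h.start] using hY 0 (by omega)
  have hK := h.norm_ge
  have hlogY : 0 ≤ Real.log (2 * Y) := Real.log_nonneg (by linarith)
  have hℓ1 := Real.one_le_exp (show 0 ≤ ℓ by linarith [h.le_ell])
  have hG1 : 1 ≤ G := by linarith
  have hex : ∃ j, T (n + j) < F^[j] τ :=
    ⟨N, (hN (n + N) (by omega)).trans_le (h.exp_iterate hτ N).1⟩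
  set j := Nat.find hex with hj
  have hjlt : ∀ i < j, F^[i] τ ≤ T (n + i) := fun i hi => not_lt.1 (Nat.find_min hex hi)
  have hlvl : ∀ i < j, F^[i] τ ≤ ℓ ∧ n + i < N := by
    intro i hi
    have h1 := (h.exp_iterate hτ i).1.trans (hjlt i hi)
    refine ⟨(hjlt i hi).trans (h.bad _ h1).1, ?_⟩
    by_contra! h2
    have := hN _ h2
    linarith
  have hjN : j ≤ N := by
    rcases Nat.eq_zero_or_pos j with h0 | h0
    · omega
    · have := (hlvl (j - 1) (by omega)).2
      omega
  refine (h.rightLipAt_prod j hτ (Nat.find_spec hex)).mono ?_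
  have hδ : ∀ k < j, 1 / 4 / G ^ N ≤ ‖Γ (n + j) (F^[j] τ) - Γ k (F^[k] t)‖ := fun k hk =>
    h.separation hN1 hNbad hN hY hG N k (by omega) (by omega) (h.exp_iterate hτ j).1
      (Nat.find_spec hex)
  have hprod := prod_norm_exp_ge (κ := κ) (z := fun i => Γ (n + i) (F^[i] τ))
    (w := fun k => Γ k (F^[k] t)) (fun i => (h.exp_iterate hτ i).2) h.exp_singular
    (by simpa using h.start) j ((div_le_self (by norm_num) (one_le_pow₀ hG1)).trans (by norm_num))
    hδ
  have hnum : ∏ i ∈ Finset.range j, (2 * Real.exp (F^[i] τ)) ≤ (2 * Real.exp ℓ) ^ j := by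
    calc ∏ i ∈ Finset.range j, (2 * Real.exp (F^[i] τ))
        ≤ ∏ _i ∈ Finset.range j, (2 * Real.exp ℓ) := by
          refine Finset.prod_le_prod (fun i _ => by positivity) fun i hi => ?_
          have := (hlvl i (Finset.mem_range.1 hi)).1
          gcongr
      _ = (2 * Real.exp ℓ) ^ j := by simp
  have hGpos : 0 < G := by linarith
  rw [Finset.prod_div_distrib]
  calc 3 / 2 * ((∏ i ∈ Finset.range j, (2 * Real.exp (F^[i] τ))) /
        ∏ i ∈ Finset.range j, ‖Complex.exp (Γ (n + i) (F^[i] τ))‖)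
      ≤ 3 / 2 * ((2 * Real.exp ℓ) ^ j / (1 / 4 / G ^ N / 2 ^ j)) := by gcongr
    _ = 6 * (4 * Real.exp ℓ) ^ j * G ^ N := by
        rw [show (4 : ℝ) * Real.exp ℓ = (2 * Real.exp ℓ) * 2 by ring, mul_pow (2 * Real.exp ℓ) 2]
        field_simp
        norm_num
    _ ≤ 6 * (4 * Real.exp ℓ) ^ N * G ^ N := by
        gcongr
        linarith
    _ = 6 * (4 * Real.exp ℓ * G) ^ N := by rw [mul_pow _ G, mul_assoc]

/-- The ray joins this point to its tail, where imaginary parts are controlled, over a potential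
range of length at most `ℓ + 1`. -/
lemma abs_im_le_of_bad (h : SingularRay κ t ℓ T s Γ) {N : ℕ} (hN1 : 1 ≤ N)
    (hNbad : ∀ n < N, F^[n] t ≤ T n) (hN : ∀ n, N ≤ n → T n < F^[n] t) {Y G : ℝ}
    (hY : ∀ k ≤ N, ‖Γ k (F^[k] t)‖ ≤ Y) (hG : 3 * (32 * Real.exp ℓ + 4 * Real.log (2 * Y)) ≤ G)
    {n : ℕ} (hn : n < N) :
    |(Γ n (F^[n] t)).im| ≤ 7 * ℓ + 1 + 6 * (4 * Real.exp ℓ * G) ^ N * (ℓ + 1) := by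
  have hb := hNbad n hn
  have hT := (h.bad n hb).1
  have h0 := F_iterate_nonneg n h.t_nonneg
  have hκY : ‖κ‖ ≤ Y := by simpa [h.start] using hY 0 (by omega)
  have hK := h.norm_ge
  have hlogY : 0 ≤ Real.log (2 * Y) := Real.log_nonneg (by linarith)
  have hG0 : 0 ≤ G := by linarith [Real.exp_pos ℓ]
  have h1 := norm_sub_le_of_rightLipAt (f := Γ n) (a := F^[n] t) (b := T n + 1)
    (L := 6 * (4 * Real.exp ℓ * G) ^ N) (by linarith)
    ((h.continuousOn n).mono fun x hx => hx.1)
    fun x hx => h.rightLipAt hN1 hNbad hN hY hG hx.1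
  have h2 := abs_le.1 ((Complex.abs_im_le_norm _).trans h1)
  have h3 := abs_le.1 (h.abs_im_le (n := n) (τ := T n + 1) (by linarith) (by linarith))
  have h4 : 6 * (4 * Real.exp ℓ * G) ^ N * (T n + 1 - F^[n] t) ≤
      6 * (4 * Real.exp ℓ * G) ^ N * (ℓ + 1) :=
    mul_le_mul_of_nonneg_left (by linarith) (by positivity)
  rw [Complex.sub_im] at h2
  have := h.le_ell
  rw [abs_le]
  constructor <;> linarith

/-- The singular orbit does not enter a half-plane that is so far to the left that it returns to a
small neighbourhood of `κ` and stays near an attracting cycle. -/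
lemma neg_half_lt_re (h : SingularRay κ t ℓ T s Γ) {N : ℕ}
    (hN : ∀ n, N ≤ n → T n < F^[n] t) {Y : ℝ}
    (hY : ∀ k ≤ N, ‖Γ k (F^[k] t)‖ ≤ Y)
    (hYN : (4 * Y) ^ N * Real.exp (1 - Y / 2) ≤ 1) {k : ℕ} (hk : k < N) :
    -(Y / 2) < (Γ k (F^[k] t)).re := by
  by_contra! hre
  set w : ℕ → ℂ := fun i => Γ i (F^[i] t) with hw
  have hκY : ‖κ‖ ≤ Y := by simpa [h.start] using hY 0 (by omega)
  have hK := h.norm_ge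
  have hY1 : 1 ≤ 4 * Y := by linarith
  have hpow : 0 < (4 * Y) ^ N := by positivity
  set ε := 1 / (4 * Y) ^ N with hε
  have hε0 : 0 ≤ ε := by positivity
  have hpowε : ∀ i ≤ N, (4 * Y) ^ i * ε ≤ 1 := by
    intro i hi
    rw [hε, mul_one_div, div_le_one hpow]
    exact pow_le_pow_right₀ hY1 hi
  -- An orbit starting within `ε` of `κ` shadows `w 0, …, w k`, losing a factor `4Y` per step. At
  -- the end the real part is at most `1 - Y/2`, so `exp` throws it back within `ε` of `κ`.
  have hstep : ∀ p, ‖w p - κ‖ ≤ ε → ‖w (p + (k + 1)) - κ‖ ≤ ε := by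
    intro p hp
    have key : ∀ i ≤ k, ‖w (p + i) - w i‖ ≤ (4 * Y) ^ i * ε := by
      intro i
      induction i with
      | zero =>
        intro _
        simpa [hw, h.start] using hp
      | succ i ih =>
        intro hi
        have h1 := ih (by omega)
        have h2 := norm_exp_sub_exp_le (h1.trans (hpowε i (by omega)))
        simp only [hw, h.exp_singular] at h2
        rw [sub_sub_sub_cancel_right] at h2
        have h3 := norm_sub_le (Γ (i + 1) (F^[i + 1] t)) κ
        have h4 := hY (i + 1) (by omega)
        refine h2.trans ?_
        calc 2 * ‖Γ (i + 1) (F^[i + 1] t) - κ‖ * ‖Γ (p + i) (F^[p + i] t) - Γ i (F^[i] t)‖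
            ≤ 2 * (2 * Y) * ((4 * Y) ^ i * ε) := by
              have h5 : ‖Γ (i + 1) (F^[i + 1] t) - κ‖ ≤ 2 * Y := by linarith
              have h6 : 0 ≤ Y := by linarith
              exact mul_le_mul (by linarith) h1 (norm_nonneg _) (by linarith)
          _ = (4 * Y) ^ (i + 1) * ε := by ring
    have h1 := (key k le_rfl).trans (hpowε k hk.le)
    have h2 := (abs_le.1 ((Complex.abs_re_le_norm _).trans h1)).2
    rw [Complex.sub_re] at h2
    have h3 := congrArg norm (h.exp_singular (p + k))
    rw [Complex.norm_exp] at h3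
    change _ = ‖w (p + (k + 1)) - κ‖ at h3
    rw [← h3]
    have h4 : Real.exp (Γ (p + k) (F^[p + k] t)).re ≤ Real.exp (1 - Y / 2) :=
      Real.exp_le_exp.2 (by simp only [hw] at h2; linarith)
    refine h4.trans ?_
    rw [hε, le_div_iff₀ hpow, mul_comm]
    exact hYN
  have hall : ∀ m : ℕ, ‖w (m * (k + 1)) - κ‖ ≤ ε := by
    intro m
    induction m with
    | zero => simp [hw, h.start, hε0]
    | succ m ih => rw [Nat.succ_mul]; exact hstep _ ih
  have hgrow : ∀ q : ℕ, (q : ℝ) ≤ F^[N + q] t := by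
    intro q
    induction q with
    | zero => simpa using F_iterate_nonneg N h.t_nonneg
    | succ q ih =>
      have h1 := F_ge_add_one ((h.two_lt_T (N + q)).trans (hN _ (by omega))).le
      rw [← add_assoc, Function.iterate_succ_apply']
      push_cast
      linarith
  obtain ⟨q, hq⟩ := exists_nat_gt (‖κ‖ + 2)
  set m := N + q with hm
  have hmle : m ≤ m * (k + 1) := Nat.le_mul_of_pos_right _ (Nat.succ_pos k)
  have h1 := abs_le.1 (h.abs_re_sub_le le_rfl (hN (m * (k + 1)) (by omega)))
  have h2 := (Complex.re_le_norm _).trans (hall m)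
  have h3 := (hgrow q).trans (F_iterate_le_iterate hmle t)
  have h4 := hpowε 0 (Nat.zero_le _)
  have h5 := Complex.re_le_norm κ
  simp only [hw, Complex.sub_re] at h2
  simp only [pow_zero, one_mul] at h4
  linarith

/-! ### Numerical inequalities for `Y ≥ exp (ℓ ^ 4)` -/

lemma exists_pow_four_eq {ℓ Y : ℝ} (hℓ : 100 ≤ ℓ) (hY : Real.exp (ℓ ^ 4) ≤ Y) :
    ∃ μ, ℓ ≤ μ ∧ Y = Real.exp (μ ^ 4) := by
  have hY0 : 0 < Y := (Real.exp_pos _).trans_le hY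
  have hlog : ℓ ^ 4 ≤ Real.log Y := (Real.le_log_iff_exp_le hY0).2 hY
  have h0 : 0 ≤ Real.log Y := le_trans (by positivity) hlog
  have h1 : √(√(Real.log Y)) ^ 4 = Real.log Y := by
    rw [show (4 : ℕ) = 2 * 2 from rfl, pow_mul, Real.sq_sqrt (Real.sqrt_nonneg _), Real.sq_sqrt h0]
  refine ⟨√(√(Real.log Y)), ?_, by rw [h1, Real.exp_log hY0]⟩
  rw [← h1] at hlog
  exact le_of_pow_le_pow_left₀ (by norm_num) (Real.sqrt_nonneg _) hlog

lemma five_hundred_le_exp {μ : ℝ} (hμ : 100 ≤ μ) : 500 ≤ Real.exp μ := by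
  have := Real.quadratic_le_exp_of_nonneg (show 0 ≤ μ by linarith)
  nlinarith

lemma log_two_mul_exp_le {μ : ℝ} (hμ : 100 ≤ μ) :
    Real.log (2 * Real.exp (μ ^ 4)) ≤ 2 * μ ^ 4 := by
  rw [Real.log_mul (by norm_num) (Real.exp_pos _).ne', Real.log_exp]
  have h1 := Real.log_two_lt_d9
  have h2 : (1 : ℝ) ≤ μ ^ 4 := one_le_pow₀ (by linarith)
  linarith

/-- With `Y = exp (μ ^ 4)` and `ℓ ≤ μ`, the base of the power is at most `exp (6μ)` and `N ≤ μ`. So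
the left side is essentially `exp (6μ ^ 2)`, negligible against `Y`. -/
lemma im_bound_lt {ℓ Y : ℝ} {N : ℕ} (hℓ : 100 ≤ ℓ) (hN : (N : ℝ) ≤ ℓ)
    (hY : Real.exp (ℓ ^ 4) ≤ Y) :
    7 * ℓ + 1 + 6 * (4 * Real.exp ℓ * (3 * (32 * Real.exp ℓ + 4 * Real.log (2 * Y)))) ^ N * (ℓ + 1)
      < Y / 2 := by
  obtain ⟨μ, hμ, rfl⟩ := exists_pow_four_eq hℓ hY
  have hμ0 : 100 ≤ μ := hℓ.trans hμ
  have hlog := log_two_mul_exp_le hμ0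
  have hE := five_hundred_le_exp hμ0
  have hlog0 : 0 ≤ Real.log (2 * Real.exp (μ ^ 4)) := Real.log_nonneg (by
    have := Real.one_le_exp (show 0 ≤ μ ^ 4 by positivity)
    linarith)
  have hexp : Real.exp ℓ ≤ Real.exp μ := Real.exp_le_exp.2 hμ
  have hμE : μ ≤ Real.exp μ := by linarith [Real.add_one_le_exp μ]
  have hbase : 4 * Real.exp ℓ * (3 * (32 * Real.exp ℓ + 4 * Real.log (2 * Real.exp (μ ^ 4)))) ≤
      Real.exp μ ^ 6 := by
    set e := Real.exp μ
    have h1 : μ ^ 4 ≤ e ^ 4 := pow_le_pow_left₀ (by linarith) hμE 4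
    have h2 : e ≤ e ^ 4 := le_self_pow₀ (by linarith) (by norm_num)
    calc 4 * Real.exp ℓ * (3 * (32 * Real.exp ℓ + 4 * Real.log (2 * Real.exp (μ ^ 4))))
        ≤ 4 * e * (3 * (32 * e ^ 4 + 4 * (2 * e ^ 4))) := by
          gcongr
          · exact hexp.trans h2
          · linarith
      _ = 480 * e ^ 5 := by ring
      _ ≤ e * e ^ 5 := by gcongr; linarith
      _ = e ^ 6 := by ring
  have hpow : (4 * Real.exp ℓ *
      (3 * (32 * Real.exp ℓ + 4 * Real.log (2 * Real.exp (μ ^ 4))))) ^ N ≤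
      Real.exp (6 * μ ^ 2) := by
    refine (pow_le_pow_left₀ (by positivity) hbase N).trans ?_
    rw [← pow_mul, ← Real.exp_nat_mul]
    apply Real.exp_le_exp.2
    push_cast
    nlinarith
  have h1 : 1 ≤ Real.exp (6 * μ ^ 2) := Real.one_le_exp (by positivity)
  calc 7 * ℓ + 1 + 6 * (4 * Real.exp ℓ *
        (3 * (32 * Real.exp ℓ + 4 * Real.log (2 * Real.exp (μ ^ 4))))) ^ N * (ℓ + 1)
      ≤ (7 * μ + 1) * Real.exp (6 * μ ^ 2) + 6 * Real.exp (6 * μ ^ 2) * (μ + 1) := by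
        gcongr
        nlinarith
    _ = (13 * μ + 7) * Real.exp (6 * μ ^ 2) := by ring
    _ ≤ (Real.exp μ * Real.exp μ / 3) * Real.exp (6 * μ ^ 2) := by
        gcongr
        nlinarith
    _ = Real.exp (μ + μ + 6 * μ ^ 2) / 3 := by
        rw [Real.exp_add, Real.exp_add]; ring
    _ ≤ Real.exp (μ ^ 4) / 3 := by
        gcongr
        nlinarith [sq_nonneg (μ ^ 2), mul_le_mul hμ0 hμ0 (by norm_num) (by linarith)]
    _ < Real.exp (μ ^ 4) / 2 := by
        have := Real.exp_pos (μ ^ 4)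
        linarith

lemma pow_mul_exp_le_one {ℓ Y : ℝ} {N : ℕ} (hℓ : 100 ≤ ℓ) (hN : (N : ℝ) ≤ ℓ)
    (hY : Real.exp (ℓ ^ 4) ≤ Y) :
    (4 * Y) ^ N * Real.exp (1 - Y / 2) ≤ 1 ∧ Real.log (2 * Y) ≤ Y / 2 := by
  obtain ⟨μ, hμ, rfl⟩ := exists_pow_four_eq hℓ hY
  have hμ0 : 100 ≤ μ := hℓ.trans hμ
  have hlog := log_two_mul_exp_le hμ0
  have h4 : (10 ^ 8 : ℝ) ≤ μ ^ 4 := by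
    calc (10 ^ 8 : ℝ) = 100 ^ 4 := by norm_num
      _ ≤ μ ^ 4 := pow_le_pow_left₀ (by norm_num) hμ0 4
  have hquad := Real.quadratic_le_exp_of_nonneg (show 0 ≤ μ ^ 4 by positivity)
  have hexp4 : 4 * Real.exp (μ ^ 4) ≤ Real.exp (2 * μ ^ 4) := by
    rw [two_mul, Real.exp_add]
    have := Real.exp_pos (μ ^ 4)
    gcongr
    nlinarith
  constructor
  · calc (4 * Real.exp (μ ^ 4)) ^ N * Real.exp (1 - Real.exp (μ ^ 4) / 2)
        ≤ Real.exp (2 * μ ^ 4) ^ N * Real.exp (1 - Real.exp (μ ^ 4) / 2) := by gcongr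
      _ = Real.exp (N * (2 * μ ^ 4) + (1 - Real.exp (μ ^ 4) / 2)) := by
          rw [← Real.exp_nat_mul, Real.exp_add]
      _ ≤ 1 := by
          rw [Real.exp_le_one_iff]
          have h5 : (N : ℝ) * (2 * μ ^ 4) ≤ μ * (2 * μ ^ 4) := by
            gcongr
            exact hN.trans hμ
          have h6 : μ ≤ μ ^ 4 / 10 ^ 6 := by
            rw [le_div_iff₀ (by norm_num)]
            have : (100 : ℝ) ^ 3 ≤ μ ^ 3 := pow_le_pow_left₀ (by norm_num) hμ0 3
            nlinarith
          nlinarith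
  · nlinarith

/-- A parameter whose singular value lies on the ray below the tail potential is bounded. -/
theorem norm_le (h : SingularRay κ t ℓ T s Γ) : ‖κ‖ ≤ ℓ ^ 4 + 7 * ℓ + 14 := by
  obtain ⟨N, hN1, hNℓ, hNbad, hN⟩ := h.exists_level
  have him := h.abs_im_kappa_le
  have hre := h.neg_two_le_re
  have hℓ := h.le_ell
  have hK := h.norm_ge
  have hnorm := Complex.norm_le_abs_re_add_abs_im κ
  suffices hre' : κ.re ≤ ℓ ^ 4 + 1 by
    have h4 : 0 ≤ ℓ ^ 4 := by positivity
    have : |κ.re| ≤ ℓ ^ 4 + 2 := by rw [abs_le]; constructor <;> linarith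
    linarith
  by_contra! hlt
  obtain ⟨k, hk, hkmax⟩ := Finset.exists_max_image (Finset.range (N + 1))
    (fun k => ‖Γ k (F^[k] t)‖) ⟨0, by simp⟩
  set Y := ‖Γ k (F^[k] t)‖ with hYdef
  have hY : ∀ i ≤ N, ‖Γ i (F^[i] t)‖ ≤ Y := fun i hi => hkmax i (Finset.mem_range.2 (by omega))
  have hκY : ‖κ‖ ≤ Y := by simpa [h.start] using hY 0 (by omega)
  have hexpY : ∀ i < N, Real.exp (Γ i (F^[i] t)).re ≤ 2 * Y := by
    intro i hi
    have h1 := congrArg norm (h.exp_singular i)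
    rw [Complex.norm_exp] at h1
    have h2 := norm_sub_le (Γ (i + 1) (F^[i + 1] t)) κ
    have h3 := hY (i + 1) (by omega)
    linarith
  have hYexp : Real.exp (ℓ ^ 4) ≤ Y := by
    have h1 := hexpY 0 (by omega)
    simp only [Function.iterate_zero, id, h.start] at h1
    have h2 := Real.exp_le_exp.2 hlt.le
    rw [Real.exp_add] at h2
    have h3 := Real.add_one_le_exp (1 : ℝ)
    nlinarith [Real.exp_pos (ℓ ^ 4)]
  obtain ⟨hpow, hlog⟩ := pow_mul_exp_le_one hℓ hNℓ hYexp
  have hkN : k < N := by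
    -- At level `N` the modulus is at most `8 exp ℓ`, far below `Y`.
    by_contra! hge
    have hkN : k = N := by
      have := Finset.mem_range.1 hk
      omega
    have h1 := h.norm_singular_level_le hN1 hNbad (hN N le_rfl)
    rw [← hkN] at h1
    have h2 : Real.exp (ℓ + ℓ) ≤ Real.exp (ℓ ^ 4) := by
      apply Real.exp_le_exp.2
      have : ℓ ^ 2 ≤ ℓ ^ 4 := pow_le_pow_right₀ (by linarith) (by norm_num)
      nlinarith
    rw [Real.exp_add] at h2
    have h3 := five_hundred_le_exp hℓ
    nlinarith
  have h1 := h.neg_half_lt_re hN hY hpow hkN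
  have h2 : (Γ k (F^[k] t)).re ≤ Real.log (2 * Y) := by
    rw [Real.le_log_iff_exp_le (by linarith)]
    exact hexpY k hkN
  have h3 := h.abs_im_le_of_bad hN1 hNbad hN hY le_rfl hkN
  have h4 := im_bound_lt hℓ hNℓ hYexp
  have h5 := Complex.norm_le_abs_re_add_abs_im (Γ k (F^[k] t))
  have h6 : |(Γ k (F^[k] t)).re| ≤ Y / 2 := by rw [abs_le]; constructor <;> linarith
  linarith

end SingularRay

/-! ### Growth of potentials -/

lemma add_mul_sq_le_F_iterate (n : ℕ) {y : ℝ} (hy : 0 ≤ y) : y + n * (y ^ 2 / 2) ≤ F^[n] y := by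
  induction n with
  | zero => simp
  | succ n ih =>
    have h1 := le_F_iterate n y
    have h2 := Real.quadratic_le_exp_of_nonneg (hy.trans h1)
    rw [Function.iterate_succ_apply']
    unfold F at *
    push_cast
    nlinarith

/-- `F` is convex and vanishes at 0. Iterated, this keeps the ratio of two orbits of `F` at or below
its initial value. -/
lemma F_mul_le {r x : ℝ} (hr0 : 0 ≤ r) (hr1 : r ≤ 1) : F (r * x) ≤ r * F x := by
  have := convexOn_exp.2 (mem_univ x) (mem_univ 0) hr0 (sub_nonneg.2 hr1) (add_sub_cancel _ _)
  simp only [smul_eq_mul, mul_zero, add_zero, Real.exp_zero, mul_one] at this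
  unfold F
  linarith

lemma F_iterate_mul_le (n : ℕ) {r x : ℝ} (hr0 : 0 ≤ r) (hr1 : r ≤ 1) :
    F^[n] (r * x) ≤ r * F^[n] x := by
  induction n with
  | zero => simp
  | succ n ih =>
    simp only [Function.iterate_succ_apply']
    exact (F_strictMono.monotone ih).trans (F_mul_le hr0 hr1)

lemma tendsto_F_iterate_atTop {y : ℝ} (hy : 0 < y) : Tendsto (fun n => F^[n] y) atTop atTop := by
  refine tendsto_atTop_mono (fun n => ?_)
    ((tendsto_natCast_atTop_atTop (R := ℝ)).atTop_mul_const (show 0 < y ^ 2 / 2 by positivity))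
  have := add_mul_sq_le_F_iterate n hy.le
  linarith

/-- The set defining `minPotential s` is nonempty, so its infimum is not a default value. Raising
the potential by 1 separates the orbits by at least `F^[n] 1`, and one further exponential makes the
quotient decay. -/
lemma ExpBounded.exists_tendsto {s : Address} (hs : ExpBounded s) :
    ∃ x : ℝ, 0 < x ∧ Tendsto (fun n : ℕ => |(s n : ℝ)| / F^[n] x) atTop (𝓝 0) := by
  obtain ⟨x, hx, hsx⟩ := hs
  refine ⟨x + 1, by linarith, ?_⟩
  rw [← tendsto_add_atTop_iff_nat 1]
  have h1 : Tendsto (fun n => Real.exp (-F^[n] 1)) atTop (𝓝 0) :=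
    Real.tendsto_exp_neg_atTop_nhds_zero.comp (tendsto_F_iterate_atTop one_pos)
  refine squeeze_zero (fun n => ?_) (fun n => ?_) h1
  · have := F_iterate_nonneg (n + 1) (show 0 ≤ x + 1 by linarith)
    positivity
  · have h2 := F_iterate_add_le n hx.le zero_le_one
    have h3 := hsx (n + 1)
    have hpos : 0 < F^[n + 1] (x + 1) :=
      (show 0 < x + 1 by linarith).trans_le (le_F_iterate _ _)
    rw [div_le_iff₀ hpos]
    refine h3.trans ?_
    simp only [Function.iterate_succ_apply']
    set a := F^[n] x
    set b := F^[n] (x + 1)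
    set c := F^[n] 1
    have h4 : Real.exp a ≤ Real.exp (-c) * Real.exp b := by
      rw [← Real.exp_add]; exact Real.exp_le_exp.2 (by linarith)
    have h5 : Real.exp (-c) ≤ 1 :=
      Real.exp_le_one_iff.2 (neg_nonpos.2 (F_iterate_nonneg n zero_le_one))
    unfold F
    nlinarith

lemma minPotential_nonneg (s : Address) : 0 ≤ minPotential s :=
  Real.sInf_nonneg fun _ hx => hx.1.le

/-- Above the minimal potential, the potentials at which a ray is outside of its tail are
logarithmic in the parameter, uniformly in the level and the parameter. -/
lemma ExpBounded.exists_bad_bound {s : Address} (hs : ExpBounded s) {t₁ : ℝ}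
    (ht₁ : minPotential s < t₁) :
    ∃ C : ℝ, 100 ≤ C ∧ ∀ (κ : ℂ) (t : ℝ) (n : ℕ), 1000 ≤ ‖κ‖ → t₁ ≤ t →
      F^[n] t ≤ tailPotential κ (shift n s) →
      tailPotential κ (shift n s) ≤ C * Real.log (‖κ‖ + 3) ∧
        (n : ℝ) + 1 ≤ C * Real.log (‖κ‖ + 3) := by
  obtain ⟨x, ⟨hx0, hx⟩, hxt⟩ := exists_lt_of_csInf_lt hs.exists_tendsto ht₁
  obtain ⟨x', hx'0, hx'⟩ := hs
  obtain ⟨n₀, hn₀⟩ := eventually_atTop.1 (hx.eventually (gt_mem_nhds one_pos))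
  have hsx : ∀ n, n₀ ≤ n → |(s n : ℝ)| ≤ F^[n] x := by
    intro n hn
    have hpos : 0 < F^[n] x := hx0.trans_le (le_F_iterate n x)
    exact ((div_lt_one hpos).1 (hn₀ n hn)).le
  -- `M` accounts for the finitely many levels below `n₀`, where only the growth parameter `x'` is
  -- available.
  set M := F^[n₀] x' with hM
  have hM0 : 0 ≤ M := F_iterate_nonneg _ hx'0.le
  have hsup : ∀ n, supPotential (shift n s) ≤ M + F^[n] x := by
    intro n
    have hxn := F_iterate_nonneg n hx0.le
    refine ciSup_le fun k => ?_
    rcases le_or_gt n₀ n with hn | hn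
    · refine (Finv_iterate_le (abs_nonneg _) ?_).trans (by linarith : F^[n] x ≤ M + F^[n] x)
      rw [← Function.iterate_add_apply, add_comm k n]
      exact hsx (n + k) (by omega)
    · refine (Finv_iterate_le (x := F^[n] x') (abs_nonneg _) ?_).trans ?_
      · rw [← Function.iterate_add_apply, add_comm k n]
        exact hx' (n + k)
      · have := F_iterate_le_iterate hn.le x'
        linarith
  have ht₁0 : 0 < t₁ := hx0.trans hxt
  set r := x / t₁ with hr
  have hr0 : 0 ≤ r := by positivity
  have hr1 : r < 1 := (div_lt_one ht₁0).2 hxt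
  have hrx : r * t₁ = x := div_mul_cancel₀ _ ht₁0.ne'
  have hr1' : 0 < 1 - r := sub_pos.2 hr1
  set A := (M + 2) / (1 - r) with hA
  have hA0 : 0 ≤ A := by positivity
  have hA1 : A * (1 - r) = M + 2 := div_mul_cancel₀ _ hr1'.ne'
  set D := 2 * A / t₁ ^ 2 with hD
  have hD0 : 0 ≤ D := by positivity
  have hD1 : D * t₁ ^ 2 = 2 * A := div_mul_cancel₀ _ (by positivity)
  refine ⟨100 + A + D, by linarith, ?_⟩
  intro κ t n hκ ht hbad
  set L := Real.log (‖κ‖ + 3) with hL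
  have hL1 : 1 ≤ L := by
    rw [hL, Real.le_log_iff_exp_le (by positivity)]
    have := Real.exp_one_lt_d9
    linarith
  have htail : tailPotential κ (shift n s) ≤ M + F^[n] x + 2 * L := by
    have := hsup n
    unfold tailPotential
    linarith
  have hy := (F_iterate_strictMono n).monotone ht
  have hx1 : F^[n] x ≤ r * F^[n] t₁ := hrx ▸ F_iterate_mul_le n hr0 hr1.le
  have hML : M + 2 * L ≤ (M + 2) * L := by nlinarith
  -- Outside the tail `F^[n] t ≤ M + r F^[n] t + 2L` with `r < 1`; solve for `F^[n] t`.
  have hy1 : F^[n] t ≤ A * L := by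
    have h1 : F^[n] t * (1 - r) ≤ A * L * (1 - r) := by
      have : r * F^[n] t₁ ≤ r * F^[n] t := by gcongr
      have h2 : A * L * (1 - r) = (M + 2) * L := by rw [← hA1]; ring
      linarith
    exact le_of_mul_le_mul_right h1 hr1'
  constructor
  · have h2 : r * F^[n] t₁ ≤ r * (A * L) := by gcongr; exact hy.trans hy1
    have h3 : (M + 2) * L = A * L - r * (A * L) := by rw [← hA1]; ring
    have h4 : 0 ≤ D * L := by positivity
    linarith
  · have h2 := add_mul_sq_le_F_iterate n ht₁0.le
    have h3 : (n : ℝ) ≤ D * L := by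
      have h4 : (n : ℝ) * t₁ ^ 2 ≤ D * L * t₁ ^ 2 := by
        have : D * L * t₁ ^ 2 = 2 * (A * L) := by rw [mul_right_comm, hD1]; ring
        linarith
      exact le_of_mul_le_mul_right h4 (by positivity)
    have h4 : 0 ≤ A * L := by positivity
    linarith

lemma eventually_log_pow_lt (C : ℝ) :
    ∀ᶠ z : ℝ in atTop, (C * Real.log z) ^ 4 + 7 * (C * Real.log z) + 14 < z - 3 := by
  have h4 := (Real.isLittleO_pow_log_id_atTop (n := 4)).const_mul_left (C ^ 4)
  have h1 := (Real.isLittleO_pow_log_id_atTop (n := 1)).const_mul_left (7 * C)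
  filter_upwards [(h4.add h1).def (show (0 : ℝ) < 1 / 2 by norm_num), eventually_gt_atTop 34]
    with z hz hz'
  rw [id, Real.norm_eq_abs, Real.norm_of_nonneg (by linarith)] at hz
  have := (le_abs_self _).trans hz
  nlinarith

/-- Parameters on a parameter ray are bounded, uniformly for potentials `t` that are bounded away
from `t_s`, unless they are smaller than `2 t`. -/
theorem ExpBounded.exists_bound {s : Address} (hs : ExpBounded s) {t₁ : ℝ}
    (ht₁ : minPotential s < t₁) :
    ∃ R : ℝ, ∀ t, t₁ ≤ t → ∀ κ ∈ paramSet s t, ‖κ‖ < R ∨ ‖κ‖ < 2 * t := by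
  obtain ⟨C, hC, hbad⟩ := hs.exists_bad_bound ht₁
  obtain ⟨R₀, hR₀⟩ := eventually_atTop.1 (eventually_log_pow_lt C)
  have hb := hs.potentialBdd
  -- Since `13 > 4π`, the part `2πi s 0` of a tail point is less than half of `‖κ‖`, which leaves
  -- `‖κ‖ < 2t`.
  refine ⟨max (max R₀ 1000) (13 * |(s 0 : ℝ)| + 1), ?_⟩
  rintro t ht κ ⟨γ, hγ, hγ0⟩
  by_contra! hcon
  obtain ⟨hR, h2t⟩ := hcon
  have hκ : 1000 ≤ ‖κ‖ := (le_max_right _ _).trans ((le_max_left _ _).trans hR)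
  have hκ0 : R₀ ≤ ‖κ‖ := (le_max_left _ _).trans ((le_max_left _ _).trans hR)
  have hκs : 13 * |(s 0 : ℝ)| + 1 ≤ ‖κ‖ := (le_max_right _ _).trans hR
  have ht0 : 0 ≤ t := (minPotential_nonneg s).trans (ht₁.le.trans ht)
  rcases lt_or_ge (tailPotential κ s) t with hlt | hle
  · have h1 := hγ.norm_sub_le hκ hb (n := 0) (τ := t) le_rfl (by rwa [shift_zero])
    rw [hγ0, zero_add] at h1
    have h2 := norm_sub_norm_le κ (t + 2 * (Real.pi : ℂ) * Complex.I * (s 0 : ℂ))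
    have h3 := norm_add_le (t : ℂ) (2 * (Real.pi : ℂ) * Complex.I * (s 0 : ℂ))
    have h4 : ‖2 * (Real.pi : ℂ) * Complex.I * (s 0 : ℂ)‖ = 2 * Real.pi * |(s 0 : ℝ)| := by
      simp [abs_of_pos Real.pi_pos]
    rw [h4, Complex.norm_real, Real.norm_of_nonneg ht0] at h3
    have := Real.pi_lt_d2
    nlinarith [abs_nonneg (s 0 : ℝ)]
  · have hL1 : 1 ≤ Real.log (‖κ‖ + 3) := by
      rw [Real.le_log_iff_exp_le (by positivity)]
      have := Real.exp_one_lt_d9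
      linarith
    have hsing : SingularRay κ t (C * Real.log (‖κ‖ + 3)) (fun n => tailPotential κ (shift n s)) s
        (fun n τ => γ n τ + κ) := by
      refine ⟨hκ, ht0, by nlinarith, fun n => (hγ.continuousOn n).add continuousOn_const, ?_, ?_,
        ?_, ?_, ?_, ?_, fun n hn => hbad κ t n hκ ht hn, by rw [hγ0, zero_add], ?_⟩
      · intro n τ hτ
        rw [add_sub_cancel_right]
        exact hγ.semiconj n τ hτ
      · exact fun n τ hτ hT => hγ.norm_sub_le hκ hb hτ hT
      · intro n a b ha ha' hb1 hb'
        rw [add_sub_add_right_eq_sub]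
        exact hγ.norm_sub_sub_le hκ hb ha ha' hb1 hb'
      · intro n
        have := (hb.shift n).tailPotential_shift_le κ
        rwa [shift_one_shift] at this
      · intro n
        have h1 := (hb.shift n).abs_le
        have h2 := two_log_pos κ
        simp only [shift, add_zero] at h1
        unfold tailPotential
        linarith
      · intro n
        rw [exp_tailPotential]
        have := Real.one_le_exp (hb.shift n).nonneg
        exact le_mul_of_one_le_left (by positivity) this
      · rwa [shift_zero]
    have h1 := hsing.norm_le
    have h2 := hR₀ (‖κ‖ + 3) (by linarith)
    linarith

/-- The admissible bounds at each `t` are upward closed, hence convex, and some constant works near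
each `t`; a partition of unity glues these constants. -/
lemma ExpBounded.exists_continuous_bound {s : Address} (hs : ExpBounded s) :
    ∃ g : C(Ioi (minPotential s), ℝ), ∀ t : Ioi (minPotential s), ∀ κ ∈ paramSet s t, ‖κ‖ < g t := by
  refine exists_continuous_forall_mem_convex_of_local_const
    (t := fun t : Ioi (minPotential s) => {y : ℝ | ∀ κ ∈ paramSet s t, ‖κ‖ < y}) ?_ ?_
  · intro t
    refine OrdConnected.convex ⟨fun a ha b _ y hy κ hκ => (ha κ hκ).trans_le hy.1⟩
  · rintro ⟨t, ht⟩
    have ht' : minPotential s < t := ht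
    obtain ⟨R, hR⟩ := hs.exists_bound (t₁ := (minPotential s + t) / 2) (by linarith)
    refine ⟨max R (2 * (t + 1)), ?_⟩
    have h1 : ∀ᶠ y in 𝓝 t, y ∈ Ioo ((minPotential s + t) / 2) (t + 1) :=
      Ioo_mem_nhds (by linarith) (by linarith)
    filter_upwards [continuous_subtype_val.continuousAt.eventually h1] with y hy κ hκ
    rcases hR y hy.1.le κ hκ with h2 | h2
    · exact h2.trans_le (le_max_left _ _)
    · exact (h2.trans (by linarith [hy.2])).trans_le (le_max_right _ _)

end ExpFamily

theorem proposition3p3 (s : ExpFamily.Address) (hs : ExpFamily.ExpBounded s) :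
    ∃ ξ : ℝ → ℝ, ContinuousOn ξ (Set.Ioi (ExpFamily.minPotential s)) ∧
      (∀ t : ℝ, ExpFamily.minPotential s < t →
        ExpFamily.paramSet s t ⊆ Metric.ball (0 : ℂ) (ξ t)) ∧
      ∃ T : ℝ, ∀ t : ℝ, T ≤ t → ξ t = 2 * t := by
  classical
  obtain ⟨g, hg⟩ := hs.exists_continuous_bound
  obtain ⟨R, hR⟩ := hs.exists_bound (t₁ := ExpFamily.minPotential s + 1) (by linarith)
  set T := max (ExpFamily.minPotential s + 1) (R / 2) with hT
  set G : ℝ → ℝ := fun t => if h : ExpFamily.minPotential s < t then g ⟨t, h⟩ else 0 with hG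
  have hGc : ContinuousOn G (Set.Ioi (ExpFamily.minPotential s)) := by
    rw [continuousOn_iff_continuous_domRestrict]
    convert g.continuous using 1
    ext ⟨t, ht⟩
    exact dif_pos ht
  -- The cutoff is 1 for `t ≤ T` and 0 for `t ≥ T + 1`. From `T` on, `R ≤ 2t`, so `2t` alone is
  -- already a bound.
  refine ⟨fun t => 2 * t + max (G t) 0 * max 0 (min 1 (T + 1 - t)), ?_, ?_, T + 1, ?_⟩
  · refine ContinuousOn.add (by fun_prop) (ContinuousOn.mul ?_ (by fun_prop))
    exact hGc.sup continuousOn_const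
  · intro t ht κ hκ
    have ht0 : 0 ≤ t := (ExpFamily.minPotential_nonneg s).trans ht.le
    rw [mem_ball_zero_iff]
    dsimp only
    rcases le_or_gt T t with hTt | hTt
    · have h1 : ‖κ‖ < 2 * t := by
        rcases hR t ((le_max_left _ _).trans hTt) κ hκ with h1 | h1
        · have := (le_max_right _ _).trans hTt
          linarith
        · exact h1
      have h2 : 0 ≤ max (G t) 0 * max 0 (min 1 (T + 1 - t)) :=
        mul_nonneg (le_max_right _ _) (le_max_left _ _)
      linarith
    · have h1 : ‖κ‖ < G t := by
        rw [hG]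
        simpa only [dif_pos ht] using hg ⟨t, ht⟩ κ hκ
      have h2 := le_max_left (G t) 0
      rw [min_eq_left (by linarith), max_eq_right zero_le_one, mul_one]
      linarith
  · intro t ht
    dsimp only
    rw [max_eq_left ((min_le_right _ _).trans (by linarith)), mul_zero, add_zero]
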